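/- Let \(\mathcal B\) be a complex Banach space and \((S(t))_{t\ge 0}\) a bounded analytic \(C_0\)-semigroup on \(\mathcal B\) whose generator \(A\) is injective (equivalently: \(A\) is densely defined and injective and \(-A\) is sectorial of angle less than \(\pi/2\)). For \(\rho\ge 0\) let \(\mathcal B_\rho=D((-A)^\rho)\) with the graph norm, and for \(\rho<0\) let \(\mathcal B_\rho\) be the completion of \(D((-A)^{\rho})\) under the norm \(\|(-A)^{\rho}\,\cdot\,\|_{\mathcal B}\). Let \(T>0\), \(0<\eta\le 1\), \(\gamma\in\mathbb R\) with \(\gamma<\eta\), \(0<\delta<\eta-\gamma\) and \(0<\kappa<\min(\eta-\gamma-\delta,1)\) with \(\kappa\le\eta\) (the last condition is automatic if \(\gamma\ge 0\)). Let \(N\in C^\eta_0([0,T];\mathcal B_{-\gamma})\), i.e. \(N\colon[0,T]\to\mathcal B_{-\gamma}\) is \(\eta\)-Hölder continuous with \(N(0)=0\). Then, for every \(u>0\), \(S(u)\) is bounded from \(D((-A)^{-\gamma})\), with the norm of \(\mathcal B_{-\gamma}\), to \(\mathcal B\), and so extends to a bounded operator \(S(u)\colon\mathcal B_{-\gamma}\to\mathcal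 B\). The convolution \[ N_A(t)=\int_0^t S(t-s)\,\mathrm dN(s):=\lim_{n\to\infty}\sum_{t^n_k\in\pi_n,\ t^n_k<t}S(t-t^n_k)\bigl(N(t^n_{k+1})-N(t^n_k)\bigr) \] exists for all \(t\in[0,T]\) as a limit in \(\mathcal B_\delta\), for every sequence of partitions \(\pi_n\) of \([0,t]\) with mesh tending to \(0\), and \(N_A\in C^\kappa_0([0,T];\mathcal B_\delta)\). Moreover, for every \(t\in[0,T]\), \(S(t-s)(N(s)-N(t))\in D(A)\) for all \(s\in[0,t)\), the function \(s\mapsto AS(t-s)(N(s)-N(t))\) is \(\mathcal B_\delta\)-valued and Bochner integrable in \(\mathcal B_\delta\) over \([0,t]\), and \[ \int_0^t S(t-s)\,\mathrm dN(s)=\int_0^t A\,S(t-s)\bigl(N(s)-N(t)\bigr)\,\mathrm ds+S(t)N(t). \] -/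

import Mathlib

open Filter Topology MeasureTheory

noncomputable section

namespace AnalyticConvolution

universe u

variable {B : Type u} [NormedAddCommGroup B] [NormedSpace ℂ B]

/-- The graph of the (possibly unbounded) operator `x ↦ lim_{t ↓ 0} F t x`, defined for exactly those
`x` for which the limit exists in `B`. -/
def limitGraph (F : ℝ → B →L[ℂ] B) : Submodule ℂ (B × B) where
  carrier := {p | Tendsto (fun t => F t p.1) (𝓝[>] (0 : ℝ)) (𝓝 p.2)}
  add_mem' := by
    intro p q hp hq
    have hp' : Tendsto (fun t => F t p.1) (𝓝[>] (0 : ℝ)) (𝓝 p.2) := hp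
    have hq' : Tendsto (fun t => F t q.1) (𝓝[>] (0 : ℝ)) (𝓝 q.2) := hq
    simpa using hp'.add hq'
  zero_mem' := by simp
  smul_mem' := by
    intro c p hp
    have hp' : Tendsto (fun t => F t p.1) (𝓝[>] (0 : ℝ)) (𝓝 p.2) := hp
    simpa using hp'.const_smul c

/-- The operator with graph `limitGraph F`. -/
def limitOp (F : ℝ → B →L[ℂ] B) : B →ₗ.[ℂ] B := (limitGraph F).toLinearPMap

/-- The graph of `limitOp F` is what it should be. -/
theorem mem_graph_limitOp (F : ℝ → B →L[ℂ] B) (x y : B) :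
    (x, y) ∈ (limitOp F).graph ↔ Tendsto (fun t => F t x) (𝓝[>] (0 : ℝ)) (𝓝 y) := by
  have h : (limitOp F).graph = limitGraph F := by
    apply Submodule.toLinearPMap_graph_eq
    rintro ⟨a, b⟩ hab (rfl : a = 0)
    have hab' : Tendsto (fun t => F t (0 : B)) (𝓝[>] (0 : ℝ)) (𝓝 b) := hab
    simp only [map_zero] at hab'
    exact (tendsto_nhds_unique hab' tendsto_const_nhds)
  rw [h]
  rfl

/-- A bounded analytic (holomorphic) strongly continuous semigroup `(S t)_{t ≥ 0}` on the complex
Banach space `B`: a strongly continuous semigroup which extends to a bounded holomorphic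
operator-valued function on some open sector `{z ≠ 0, |arg z| < θ}` around the positive half-line.
(The semigroup law and the strong continuity at `0` on the sector are then automatic.) Equivalently,
its generator `A` is densely defined and `-A` is sectorial of angle less than `π / 2`.
Only the values `S t` with `t ≥ 0` matter. -/
structure IsBoundedAnalyticSemigroup (S : ℝ → B →L[ℂ] B) : Prop where
  zero : S 0 = ContinuousLinearMap.id ℂ B
  add : ∀ s t : ℝ, 0 ≤ s → 0 ≤ t → S (s + t) = (S s).comp (S t)
  continuous : ∀ x : B, ContinuousOn (fun t => S t x) (Set.Ici 0)
  analytic : ∃ θ : ℝ, 0 < θ ∧ θ ≤ Real.pi / 2 ∧ ∃ U : ℂ → B →L[ℂ] B,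
    DifferentiableOn ℂ U {z : ℂ | z ≠ 0 ∧ |z.arg| < θ} ∧
    (∀ t : ℝ, 0 < t → U (t : ℂ) = S t) ∧
    ∃ M : ℝ, ∀ z : ℂ, z ≠ 0 → |z.arg| < θ → ‖U z‖ ≤ M

/-- The infinitesimal generator `A x = lim_{h ↓ 0} (S h x - x) / h`. -/
def generator (S : ℝ → B →L[ℂ] B) : B →ₗ.[ℂ] B :=
  limitOp fun h => ((h : ℂ)⁻¹) • (S h - ContinuousLinearMap.id ℂ B)

/-- For `α > 0` and `t > 0`, the bounded operator
`(-A)^α S t = Γ(n - α)⁻¹ ∫₀^∞ u ^ (n - α - 1) (-A)^n S (t + u) du`, with `n = ⌊α⌋ + 1`.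
Here `(-A)^n S r = (-1)^n (d/dr)^n S r` for `r > 0`. -/
def fracPowSemigroup (S : ℝ → B →L[ℂ] B) (α t : ℝ) : B →L[ℂ] B :=
  (Real.Gamma ((⌊α⌋₊ + 1 : ℕ) - α))⁻¹ •
    ∫ u in Set.Ioi (0 : ℝ), u ^ (((⌊α⌋₊ + 1 : ℕ) : ℝ) - α - 1) •
      ((-1 : ℝ) ^ (⌊α⌋₊ + 1) • iteratedDeriv (⌊α⌋₊ + 1) S (t + u))

/-- The fractional power `(-A)^ρ`, `ρ ∈ ℝ`, of the negative of the (injective) generator `A` of a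
bounded analytic semigroup `S`. For `ρ > 0` it is the closed operator
`(-A)^ρ x = lim_{t ↓ 0} (-A)^ρ S t x` (domain: all `x` for which the limit exists), `(-A)^0` is the
identity, and for `ρ < 0` it is the inverse of the injective operator `(-A)^(-ρ)`. -/
def fracPow (S : ℝ → B →L[ℂ] B) (ρ : ℝ) : B →ₗ.[ℂ] B :=
  if 0 < ρ then limitOp (fracPowSemigroup S ρ)
  else if ρ = 0 then ⟨⊤, (⊤ : Submodule ℂ B).subtype⟩
  else (limitOp (fracPowSemigroup S (-ρ))).inverse

/-- The domain `D((-A)^ρ)`, a type synonym that carries its own norm, see below. -/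
def FracDomain (S : ℝ → B →L[ℂ] B) (ρ : ℝ) : Type u := (fracPow S ρ).domain

instance (S : ℝ → B →L[ℂ] B) (ρ : ℝ) : AddCommGroup (FracDomain S ρ) :=
  inferInstanceAs (AddCommGroup (fracPow S ρ).domain)

instance (S : ℝ → B →L[ℂ] B) (ρ : ℝ) : Module ℂ (FracDomain S ρ) :=
  inferInstanceAs (Module ℂ (fracPow S ρ).domain)

/-- The inclusion `D((-A)^ρ) ⊆ B`. -/
def FracDomain.incl (S : ℝ → B →L[ℂ] B) (ρ : ℝ) : FracDomain S ρ →ₗ[ℂ] B :=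
  (fracPow S ρ).domain.subtype

/-- The operator `(-A)^ρ : D((-A)^ρ) → B`. -/
def FracDomain.pow (S : ℝ → B →L[ℂ] B) (ρ : ℝ) : FracDomain S ρ →ₗ[ℂ] B :=
  (fracPow S ρ).toFun

/-- `D((-A)^ρ)` is normed by pulling back the (maximum) norm of `B × B` under this map. -/
def FracDomain.normMap (S : ℝ → B →L[ℂ] B) (ρ : ℝ) : FracDomain S ρ →ₗ[ℂ] B × B :=
  (if 0 ≤ ρ then FracDomain.incl S ρ else 0).prod (FracDomain.pow S ρ)

/-- For `ρ ≥ 0`, `D((-A)^ρ)` carries the graph norm `max ‖x‖ ‖(-A)^ρ x‖`, for which it is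
complete; for `ρ < 0` it carries the norm `‖(-A)^ρ x‖`. -/
instance (S : ℝ → B →L[ℂ] B) (ρ : ℝ) : SeminormedAddCommGroup (FracDomain S ρ) :=
  SeminormedAddCommGroup.induced (FracDomain S ρ) (B × B) (FracDomain.normMap S ρ)

instance (S : ℝ → B →L[ℂ] B) (ρ : ℝ) : NormedSpace ℂ (FracDomain S ρ) :=
  NormedSpace.induced ℂ (FracDomain S ρ) (B × B) (FracDomain.normMap S ρ)

theorem FracDomain.norm_of_nonneg (S : ℝ → B →L[ℂ] B) {ρ : ℝ} (h : 0 ≤ ρ) (x : FracDomain S ρ) :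
    ‖x‖ = max ‖FracDomain.incl S ρ x‖ ‖FracDomain.pow S ρ x‖ := by
  change ‖FracDomain.normMap S ρ x‖ = _
  simp [FracDomain.normMap, h, Prod.norm_def]

theorem FracDomain.norm_of_neg (S : ℝ → B →L[ℂ] B) {ρ : ℝ} (h : ρ < 0) (x : FracDomain S ρ) :
    ‖x‖ = ‖FracDomain.pow S ρ x‖ := by
  change ‖FracDomain.normMap S ρ x‖ = _
  simp [FracDomain.normMap, not_le.mpr h, Prod.norm_def]

/-- The scale of Banach spaces: the completion of `D((-A)^ρ)`. For `ρ < 0` this is the completion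
for the norm `‖(-A)^ρ x‖`; for `ρ ≥ 0` the graph norm is complete, so that nothing is added. -/
abbrev Scale (S : ℝ → B →L[ℂ] B) (ρ : ℝ) : Type u := UniformSpace.Completion (FracDomain S ρ)

/-- The continuous extension of `S t : D((-A)^ρ) → B` to a bounded operator `Scale S ρ → B`.
(By convention it is `0` if there is no such extension; this happens only for `ρ < 0` and `t ≤ 0`.) -/
def extendedSemigroup [CompleteSpace B] (S : ℝ → B →L[ℂ] B) (ρ t : ℝ) : Scale S ρ →L[ℂ] B :=
  ((S t).toLinearMap ∘ₗ FracDomain.incl S ρ).extendOfNorm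
    (UniformSpace.Completion.toComplL (𝕜 := ℂ) (E := FracDomain S ρ)).toLinearMap

/-- A finite partition `0 = t_0 < t_1 < ... < t_m = t` of `[0, t]`. -/
structure TimePartition (t : ℝ) where
  m : ℕ
  pt : ℕ → ℝ
  pt_zero : pt 0 = 0
  pt_last : pt m = t
  pt_lt : ∀ k < m, pt k < pt (k + 1)

/-- The mesh `max_k (t_{k+1} - t_k)` of a partition. -/
def TimePartition.mesh {t : ℝ} (π : TimePartition t) : ℝ :=
  ⨆ k : Fin π.m, (π.pt (k + 1) - π.pt k)

/-- The Riemann sum `∑_k S(t - t_k) (X(t_{k+1}) - X(t_k)) ∈ B` of a path `X` in `Scale S ρ`. -/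
def riemannSum [CompleteSpace B] (S : ℝ → B →L[ℂ] B) {ρ : ℝ} (X : ℝ → Scale S ρ) {t : ℝ}
    (π : TimePartition t) : B :=
  ∑ k ∈ Finset.range π.m, extendedSemigroup S ρ (t - π.pt k) (X (π.pt (k + 1)) - X (π.pt k))

/-- `y = ∫₀ᵗ S(t - s) dX(s)` in `D((-A)^δ)`: for every sequence of partitions of `[0, t]` with mesh
tending to `0`, the Riemann sums lie in `D((-A)^δ)` and converge there to `y`. -/
def IsConvolution [CompleteSpace B] (S : ℝ → B →L[ℂ] B) {ρ δ : ℝ} (X : ℝ → Scale S ρ) (t : ℝ)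
    (y : FracDomain S δ) : Prop :=
  ∀ π : ℕ → TimePartition t, Tendsto (fun n => (π n).mesh) atTop (𝓝 0) →
    ∃ R : ℕ → FracDomain S δ, (∀ n, FracDomain.incl S δ (R n) = riemannSum S X (π n)) ∧
      Tendsto R atTop (𝓝 y)

/-- `f ∈ C^η_0([0, T]; E)`: `f` is `η`-Hölder continuous on `[0, T]` and `f 0 = 0`. -/
def MemHolderZero {E : Type*} [SeminormedAddCommGroup E] (η T : ℝ) (f : ℝ → E) : Prop :=
  f 0 = 0 ∧ ∃ C : NNReal, HolderOnWith C η.toNNReal f (Set.Icc 0 T)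

end AnalyticConvolution

end

open AnalyticConvolution

noncomputable section

namespace AnalyticConvolution

universe u

/-! Since `N 0 = 0`, summation by parts turns the Riemann sum into S(t)N(t) plus the sum of (S(t -
t_k) - S(t - t_{k+1}))(N(t_{k+1}) - N(t)), and each difference of semigroup operators is the
integral of A S(t - s) over [t_k, t_{k+1}]. Replacing N(t_{k+1}) by N(s) there gives the asserted
formula; the error is the integral of A S(t - s)(N(t_{k+1}) - N(s)). From B_{-γ} to B_δ the norm of
A S(u) is O(u^(-1 - ν)) on (0, T], with ν = max(γ + δ, -1). Splitting η = κ + (η - κ) bounds the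
error by mesh^κ times the integral of (t - s)^(η - κ - 1 - ν), finite because κ < η - ν
(`norm_kernel_riemann_sum_sub_le`). The same split gives Hölder continuity of order κ
(`exists_norm_kernelConvolution_sub_le`).

The norm bounds come from a calculus of the operators (-A)^α S(t), written as Weyl fractional
integrals of derivatives of S. The Beta integral makes Weyl integrals compose, hence (-A)^α S(s)
(-A)^β S(t) = (-A)^(α + β) S(s + t) (`smoothing_mul`), and all powers decay like t^(-α).

Unbounded operators are avoided: (-A)^δ x = y is equivalent to (-A)^δ S(t) x = S(t) y for all t > 0,
an equation between bounded operators. A point of D((-A)^δ) is treated as a pair (x, y) in B × B,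
the kernel takes values in B × B, and sums and integrals stay in the graph. On B_{-γ} the semigroup
factors as (-A)^max(γ, 0) S(t) J with J bounded into B (`exists_scale_factorization`), so that every
estimate takes place in B. -/

/-! ### The Beta integral and convolution of powers -/

theorem integral_rpow_mul_sub_rpow {a b w : ℝ} (ha : 0 < a) (hb : 0 < b) (hw : 0 < w) :
    ∫ u in (0 : ℝ)..w, u ^ (a - 1) * (w - u) ^ (b - 1) =
      w ^ (a + b - 1) * (Real.Gamma a * Real.Gamma b / Real.Gamma (a + b)) := by
  have h1 := Complex.betaIntegral_scaled (a : ℂ) (b : ℂ) hw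
  have h2 := Complex.Gamma_mul_Gamma_eq_betaIntegral (s := (a : ℂ)) (t := (b : ℂ))
    (by simpa using ha) (by simpa using hb)
  have hG : (Real.Gamma (a + b) : ℂ) ≠ 0 := by
    exact_mod_cast (Real.Gamma_pos_of_pos (add_pos ha hb)).ne'
  rw [← Complex.ofReal_add, Complex.Gamma_ofReal, Complex.Gamma_ofReal, Complex.Gamma_ofReal,
    mul_comm] at h2
  have h3 : Complex.betaIntegral a b =
      ((Real.Gamma a * Real.Gamma b / Real.Gamma (a + b) : ℝ) : ℂ) := by
    push_cast
    rw [eq_div_iff hG, mul_comm (Real.Gamma a : ℂ), h2, mul_comm]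
  rw [h3] at h1
  apply Complex.ofReal_injective
  rw [← intervalIntegral.integral_ofReal, Complex.ofReal_mul, Complex.ofReal_cpow hw.le]
  push_cast at h1 ⊢
  rw [← h1]
  apply intervalIntegral.integral_congr
  intro u hu
  rw [Set.uIcc_of_le hw.le] at hu
  simp only
  rw [Complex.ofReal_cpow hu.1, Complex.ofReal_cpow (sub_nonneg.2 hu.2)]
  push_cast
  rfl

/-- The power `u ^ (a - 1)` on `(0, ∞)`, extended by zero. -/
def powKernel (a : ℝ) : ℝ → ℝ := (Set.Ioi (0 : ℝ)).indicator fun u => u ^ (a - 1)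

theorem measurable_powKernel (a : ℝ) : Measurable (powKernel a) :=
  (measurable_id.pow_const (a - 1)).indicator measurableSet_Ioi

theorem powKernel_nonneg (a u : ℝ) : 0 ≤ powKernel a u :=
  Set.indicator_nonneg (fun _ hu => Real.rpow_nonneg (le_of_lt hu) _) u

theorem powKernel_mul_powKernel_sub (a b w : ℝ) :
    (fun u => powKernel a u * powKernel b (w - u)) =
      (Set.Ioo 0 w).indicator fun u => u ^ (a - 1) * (w - u) ^ (b - 1) := by
  funext u
  simp only [powKernel, Set.indicator_apply, Set.mem_Ioi, Set.mem_Ioo, sub_pos]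
  split_ifs <;> simp_all

theorem integral_powKernel_mul {a b : ℝ} (ha : 0 < a) (hb : 0 < b) {w : ℝ} (hw : 0 < w) :
    ∫ u, powKernel a u * powKernel b (w - u) =
      w ^ (a + b - 1) * (Real.Gamma a * Real.Gamma b / Real.Gamma (a + b)) := by
  rw [powKernel_mul_powKernel_sub, integral_indicator measurableSet_Ioo,
    ← integral_Ioc_eq_integral_Ioo, ← intervalIntegral.integral_of_le hw.le,
    integral_rpow_mul_sub_rpow ha hb hw]

/-- A non-integrable function has integral zero by convention, but the Beta value is positive. -/
theorem integrable_powKernel_mul {a b : ℝ} (ha : 0 < a) (hb : 0 < b) {w : ℝ} (hw : 0 < w) :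
    Integrable fun u => powKernel a u * powKernel b (w - u) := by
  by_contra h
  have h1 := integral_powKernel_mul ha hb hw
  rw [integral_undef h] at h1
  have := Real.Gamma_pos_of_pos ha
  have := Real.Gamma_pos_of_pos hb
  have := Real.Gamma_pos_of_pos (add_pos ha hb)
  have : 0 < w ^ (a + b - 1) * (Real.Gamma a * Real.Gamma b / Real.Gamma (a + b)) := by positivity
  linarith

/-! ### Weyl fractional integrals -/

section Weyl

theorem continuousOn_add_left {E : Type*} [TopologicalSpace E] {f : ℝ → E}
    (hf : ContinuousOn f (Set.Ioi 0)) {t : ℝ} (ht : 0 < t) :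
    ContinuousOn (fun u => f (t + u)) (Set.Ioi 0) :=
  hf.comp (by fun_prop) fun u hu => add_pos ht hu

variable {E : Type*} [NormedAddCommGroup E] [NormedSpace ℝ E]

theorem integral_Ioi_rpow_smul (a : ℝ) (g : ℝ → E) :
    ∫ u in Set.Ioi (0 : ℝ), u ^ (a - 1) • g u = ∫ u, powKernel a u • g u := by
  rw [← integral_indicator measurableSet_Ioi]
  congr 1
  funext u
  simp only [powKernel, Set.indicator_apply]
  split_ifs <;> simp

/-- Fubini after the substitution w = u + v: for fixed w the integral over u is a Beta integral,
which produces the power w^(a + b - 1). -/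
theorem integral_rpow_smul_integral_rpow_smul [CompleteSpace E] {a b : ℝ} (ha : 0 < a) (hb : 0 < b) (g : ℝ → E)
    (hg : AEStronglyMeasurable g (volume.restrict (Set.Ioi 0)))
    (hi : IntegrableOn (fun w => w ^ (a + b - 1) • g w) (Set.Ioi 0)) :
    ∫ u in Set.Ioi (0 : ℝ), u ^ (a - 1) • ∫ v in Set.Ioi (0 : ℝ), v ^ (b - 1) • g (u + v) =
      (Real.Gamma a * Real.Gamma b / Real.Gamma (a + b)) •
        ∫ w in Set.Ioi (0 : ℝ), w ^ (a + b - 1) • g w := by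
  set c := Real.Gamma a * Real.Gamma b / Real.Gamma (a + b) with hc
  set G : ℝ → E := (Set.Ioi (0 : ℝ)).indicator g with hG
  have hGm : AEStronglyMeasurable G := (aestronglyMeasurable_indicator_iff measurableSet_Ioi).2 hg
  let F : ℝ → ℝ → E := fun w u => (powKernel a u * powKernel b (w - u)) • G w
  have hFw : ∀ w, ∫ u, F w u = (Set.Ioi (0 : ℝ)).indicator (fun w => c • w ^ (a + b - 1) • g w) w := by
    intro w
    simp only [F]
    rw [integral_smul_const]
    by_cases hw : 0 < w
    · rw [integral_powKernel_mul ha hb hw, Set.indicator_of_mem (Set.mem_Ioi.2 hw), hG,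
        Set.indicator_of_mem (Set.mem_Ioi.2 hw), smul_smul, mul_comm]
    · simp [hG, hw]
  have hFint : Integrable (Function.uncurry F) (volume.prod volume) := by
    rw [integrable_prod_iff]
    · constructor
      · refine Eventually.of_forall fun w => ?_
        by_cases hw : 0 < w
        · exact (integrable_powKernel_mul ha hb hw).smul_const (G w)
        · simp [F, hG, hw]
      · have h1 : (fun w => ∫ u, ‖Function.uncurry F (w, u)‖) =
            fun w => ‖(Set.Ioi (0 : ℝ)).indicator (fun w => c • w ^ (a + b - 1) • g w) w‖ := by
          funext w
          rw [← hFw]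
          simp only [Function.uncurry, F, norm_smul]
          rw [integral_mul_const, integral_smul_const, norm_smul]
          congr 1
          rw [Real.norm_of_nonneg (integral_nonneg fun u =>
            mul_nonneg (powKernel_nonneg _ _) (powKernel_nonneg _ _))]
          exact integral_congr_ae (Eventually.of_forall fun u => Real.norm_of_nonneg
            (mul_nonneg (powKernel_nonneg _ _) (powKernel_nonneg _ _)))
        rw [h1]
        exact ((integrable_indicator_iff measurableSet_Ioi).2 (hi.smul c)).norm
    · refine AEStronglyMeasurable.smul (Measurable.aestronglyMeasurable ?_) hGm.comp_fst
      exact ((measurable_powKernel a).comp measurable_snd).mul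
        ((measurable_powKernel b).comp (measurable_fst.sub measurable_snd))
  have hFu : ∀ u, ∫ w, F w u =
      powKernel a u • ∫ v in Set.Ioi (0 : ℝ), v ^ (b - 1) • g (u + v) := by
    intro u
    simp only [F, mul_smul]
    rw [integral_smul]
    by_cases hu : 0 < u
    · congr 1
      rw [integral_Ioi_rpow_smul b (fun v => g (u + v)),
        ← integral_sub_right_eq_self (fun v => powKernel b v • g (u + v)) u]
      refine integral_congr_ae (Eventually.of_forall fun w => ?_)
      simp only [hG, powKernel, Set.indicator_apply, Set.mem_Ioi, sub_pos]
      split_ifs with h1 h2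
      · simp
      · exact absurd (hu.trans h1) h2
      · simp
      · simp
    · simp [powKernel, hu]
  rw [integral_Ioi_rpow_smul a]
  simp_rw [← hFu]
  rw [← integral_integral_swap hFint]
  simp_rw [hFw]
  rw [integral_indicator measurableSet_Ioi, integral_smul]

/-- The Weyl fractional integral of order `a`. -/
def weyl (a : ℝ) (f : ℝ → E) (t : ℝ) : E :=
  (Real.Gamma a)⁻¹ • ∫ u in Set.Ioi (0 : ℝ), u ^ (a - 1) • f (t + u)

/-- `f` is continuous on `(0, ∞)` and is there `O(t ^ (-p))`. -/
def PowerDecay (p : ℝ) (f : ℝ → E) : Prop :=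
  ContinuousOn f (Set.Ioi 0) ∧ ∃ C, 0 ≤ C ∧ ∀ t, 0 < t → ‖f t‖ ≤ C * t ^ (-p)

/-- Split at r: near 0 integrability needs a > 0, near infinity it needs a < p. -/
theorem integrableOn_rpow_smul {a p r A C : ℝ} (ha : 0 < a) (hap : a < p) (hr : 0 < r)
    {F : ℝ → E} (hF : ContinuousOn F (Set.Ioi 0))
    (h1 : ∀ u, 0 < u → u ≤ r → ‖F u‖ ≤ A) (h2 : ∀ u, r < u → ‖F u‖ ≤ C * u ^ (-p)) :
    IntegrableOn (fun u => u ^ (a - 1) • F u) (Set.Ioi 0) ∧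
      ‖∫ u in Set.Ioi (0 : ℝ), u ^ (a - 1) • F u‖ ≤
        A * (r ^ a / a) + C * (r ^ (a - p) / (p - a)) := by
  have hm : ContinuousOn (fun u => u ^ (a - 1) • F u) (Set.Ioi 0) :=
    (continuousOn_id.rpow_const fun x hx => Or.inl (ne_of_gt hx)).smul hF
  have i1 : IntegrableOn (fun u : ℝ => A * u ^ (a - 1)) (Set.Ioc 0 r) :=
    ((intervalIntegrable_iff_integrableOn_Ioc_of_le hr.le).1
      (intervalIntegral.intervalIntegrable_rpow' (by linarith))).const_mul A
  have i2 : IntegrableOn (fun u : ℝ => C * u ^ (a - p - 1)) (Set.Ioi r) :=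
    (integrableOn_Ioi_rpow_of_lt (by linarith) hr).const_mul C
  have b1 : ∀ u ∈ Set.Ioc 0 r, ‖u ^ (a - 1) • F u‖ ≤ A * u ^ (a - 1) := by
    intro u hu
    rw [norm_smul, Real.norm_of_nonneg (Real.rpow_nonneg hu.1.le _), mul_comm]
    exact mul_le_mul_of_nonneg_right (h1 u hu.1 hu.2) (Real.rpow_nonneg hu.1.le _)
  have b2 : ∀ u ∈ Set.Ioi r, ‖u ^ (a - 1) • F u‖ ≤ C * u ^ (a - p - 1) := by
    intro u hu
    have hu0 : 0 < u := hr.trans hu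
    rw [norm_smul, Real.norm_of_nonneg (Real.rpow_nonneg hu0.le _), mul_comm]
    refine (mul_le_mul_of_nonneg_right (h2 u hu) (Real.rpow_nonneg hu0.le _)).trans_eq ?_
    rw [mul_assoc, ← Real.rpow_add hu0]
    ring_nf
  have j1 : IntegrableOn (fun u => u ^ (a - 1) • F u) (Set.Ioc 0 r) :=
    i1.mono' ((hm.mono fun x hx => hx.1).aestronglyMeasurable measurableSet_Ioc)
      ((ae_restrict_iff' measurableSet_Ioc).2 (Eventually.of_forall b1))
  have j2 : IntegrableOn (fun u => u ^ (a - 1) • F u) (Set.Ioi r) :=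
    i2.mono' ((hm.mono fun x hx => hr.trans hx).aestronglyMeasurable measurableSet_Ioi)
      ((ae_restrict_iff' measurableSet_Ioi).2 (Eventually.of_forall b2))
  rw [← Set.Ioc_union_Ioi_eq_Ioi hr.le]
  refine ⟨j1.union j2, ?_⟩
  rw [setIntegral_union (Set.Ioc_disjoint_Ioi le_rfl) measurableSet_Ioi j1 j2]
  refine (norm_add_le _ _).trans (add_le_add ?_ ?_)
  · refine (norm_integral_le_of_norm_le i1
      ((ae_restrict_iff' measurableSet_Ioc).2 (Eventually.of_forall b1))).trans_eq ?_
    rw [integral_const_mul, ← intervalIntegral.integral_of_le hr.le,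
      integral_rpow (Or.inl (by linarith)), sub_add_cancel, Real.zero_rpow ha.ne', sub_zero]
  · refine (norm_integral_le_of_norm_le i2
      ((ae_restrict_iff' measurableSet_Ioi).2 (Eventually.of_forall b2))).trans_eq ?_
    rw [integral_const_mul, integral_Ioi_rpow_of_lt (by linarith) hr, sub_add_cancel,
      ← neg_sub p a, neg_div_neg_eq]

theorem PowerDecay.integrable {p a : ℝ} {f : ℝ → E} (hf : PowerDecay p f) (ha : 0 < a)
    (hap : a < p) {t : ℝ} (ht : 0 < t) :
    IntegrableOn (fun u => u ^ (a - 1) • f (t + u)) (Set.Ioi 0) := by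
  obtain ⟨hc, C, hC, hb⟩ := hf
  refine (integrableOn_rpow_smul (A := C * t ^ (-p)) (C := C) ha hap ht
    (continuousOn_add_left hc ht) (fun u hu _ => ?_) (fun u hu => ?_)).1
  · exact (hb _ (add_pos ht hu)).trans (mul_le_mul_of_nonneg_left
      (Real.rpow_le_rpow_of_nonpos ht (by linarith) (by linarith)) hC)
  · have hu0 : 0 < u := ht.trans hu
    exact (hb _ (add_pos ht hu0)).trans (mul_le_mul_of_nonneg_left
      (Real.rpow_le_rpow_of_nonpos hu0 (by linarith) (by linarith)) hC)

/-- Splitting at r = t makes both pieces scale as t^(a - p), since t + u is at least t and at least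
u. -/
theorem PowerDecay.norm_weyl_le {p a : ℝ} {f : ℝ → E} (hf : PowerDecay p f) (ha : 0 < a)
    (hap : a < p) : ∃ C, 0 ≤ C ∧ ∀ t, 0 < t → ‖weyl a f t‖ ≤ C * t ^ (-(p - a)) := by
  obtain ⟨hc, C, hC, hb⟩ := hf
  have hG := Real.Gamma_pos_of_pos ha
  have hpa : 0 < p - a := sub_pos.2 hap
  refine ⟨(Real.Gamma a)⁻¹ * (C * (1 / a + 1 / (p - a))), by positivity, fun t ht => ?_⟩
  have := (integrableOn_rpow_smul (A := C * t ^ (-p)) (C := C) ha hap ht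
    (continuousOn_add_left hc ht) (fun u hu _ => ?_) (fun u hu => ?_)).2
  · rw [weyl, norm_smul, norm_inv, Real.norm_of_nonneg hG.le, mul_assoc]
    refine mul_le_mul_of_nonneg_left (this.trans_eq ?_) (by positivity)
    have e1 : t ^ (-(p - a)) = t ^ (-p) * t ^ a := by rw [← Real.rpow_add ht]; ring_nf
    have e2 : t ^ (a - p) = t ^ (-p) * t ^ a := by rw [← Real.rpow_add ht]; ring_nf
    rw [e1, e2]
    ring
  · exact (hb _ (add_pos ht hu)).trans (mul_le_mul_of_nonneg_left
      (Real.rpow_le_rpow_of_nonpos ht (by linarith) (by linarith)) hC)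
  · have hu0 : 0 < u := ht.trans hu
    exact (hb _ (add_pos ht hu0)).trans (mul_le_mul_of_nonneg_left
      (Real.rpow_le_rpow_of_nonpos hu0 (by linarith) (by linarith)) hC)

theorem PowerDecay.weyl_weyl [CompleteSpace E] {p a b : ℝ} {f : ℝ → E} (hf : PowerDecay p f) (ha : 0 < a)
    (hb : 0 < b) (hp : a + b < p) {t : ℝ} (ht : 0 < t) :
    weyl a (weyl b f) t = weyl (a + b) f t := by
  have h := integral_rpow_smul_integral_rpow_smul ha hb (fun w => f (t + w))
    ((continuousOn_add_left hf.1 ht).aestronglyMeasurable measurableSet_Ioi)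
    (hf.integrable (add_pos ha hb) hp ht)
  have hGa := (Real.Gamma_pos_of_pos ha).ne'
  have hGb := (Real.Gamma_pos_of_pos hb).ne'
  simp only [weyl]
  simp_rw [smul_comm _ (Real.Gamma b)⁻¹]
  rw [integral_smul]
  simp_rw [add_assoc]
  rw [h, smul_smul, smul_smul]
  congr 1
  field_simp

theorem weyl_congr {a t : ℝ} {f g : ℝ → E} (ht : 0 < t) (h : ∀ s, 0 < s → f s = g s) :
    weyl a f t = weyl a g t := by
  simp only [weyl]
  congr 1
  exact setIntegral_congr_fun measurableSet_Ioi fun u hu => by rw [h _ (add_pos ht hu)]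

end Weyl

/-! ### Fractional powers times the semigroup, in a Banach algebra -/

section BanachAlgebra

variable {𝔸 : Type*} [NormedRing 𝔸] [NormedAlgebra ℝ 𝔸]

/-- A bounded, norm differentiable semigroup `(S t)_{t > 0}` with `‖S' t‖ = O(1 / t)`, in a Banach
algebra. -/
structure IsSmoothingSemigroup (S : ℝ → 𝔸) : Prop where
  add : ∀ s t : ℝ, 0 < s → 0 < t → S (s + t) = S s * S t
  differentiableAt : ∀ t : ℝ, 0 < t → DifferentiableAt ℝ S t
  bounded : ∃ M, 0 ≤ M ∧ ∀ t : ℝ, 0 < t → ‖S t‖ ≤ M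
  deriv_bounded : ∃ C, 0 ≤ C ∧ ∀ t : ℝ, 0 < t → ‖deriv S t‖ ≤ C / t

namespace IsSmoothingSemigroup

variable {S : ℝ → 𝔸} (hS : IsSmoothingSemigroup S)
include hS

/-- Near s + t the n-th derivative at x is S(x - t) times a constant, so one derivative of S yields
the next one. -/
theorem hasDerivAt_iteratedDeriv_of_mul {n : ℕ}
    (h : ∀ s t : ℝ, 0 < s → 0 < t → iteratedDeriv n S (s + t) = S s * iteratedDeriv n S t)
    {s t : ℝ} (hs : 0 < s) (ht : 0 < t) :
    HasDerivAt (iteratedDeriv n S) (deriv S s * iteratedDeriv n S t) (s + t) := by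
  have h1 : HasDerivAt (fun x => S (x - t) * iteratedDeriv n S t)
      (deriv S s * iteratedDeriv n S t) (s + t) := by
    refine HasDerivAt.mul_const ?_ _
    have h2 : HasDerivAt S (deriv S s) (s + t - t) := by
      rw [add_sub_cancel_right]; exact (hS.differentiableAt s hs).hasDerivAt
    exact h2.comp_sub_const (s + t) t
  refine h1.congr_of_eventuallyEq ?_
  filter_upwards [lt_mem_nhds (lt_add_of_pos_left t hs)] with x hx
  rw [← h _ _ (sub_pos.2 hx) ht, sub_add_cancel]

theorem iteratedDeriv_add (n : ℕ) : ∀ s t : ℝ, 0 < s → 0 < t →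
    iteratedDeriv n S (s + t) = S s * iteratedDeriv n S t := by
  induction n with
  | zero => simpa using hS.add
  | succ n ih =>
    have hd : ∀ r s t : ℝ, 0 < r → 0 < s → 0 < t → deriv S (r + s) = S r * deriv S s := by
      intro r s t hr hs ht
      have h1 : HasDerivAt (fun x => S (r + x)) (deriv S (r + s)) s := by
        exact (hS.differentiableAt (r + s) (add_pos hr hs)).hasDerivAt.comp_const_add r s
      have h2 : HasDerivAt (fun x => S r * S x) (S r * deriv S s) s :=
        (hS.differentiableAt s hs).hasDerivAt.const_mul (S r)
      refine h1.unique (h2.congr_of_eventuallyEq ?_)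
      filter_upwards [lt_mem_nhds hs] with x hx
      exact hS.add r x hr hx
    intro s t hs ht
    have ht2 := half_pos ht
    have e1 := (hS.hasDerivAt_iteratedDeriv_of_mul ih (add_pos hs ht2) ht2).deriv
    have e2 := (hS.hasDerivAt_iteratedDeriv_of_mul ih ht2 ht2).deriv
    rw [add_halves] at e2
    rw [add_assoc, add_halves] at e1
    rw [iteratedDeriv_succ, e1, e2, hd s (t / 2) t hs ht2 ht, mul_assoc]

theorem hasDerivAt_iteratedDeriv (n : ℕ) {s t : ℝ} (hs : 0 < s) (ht : 0 < t) :
    HasDerivAt (iteratedDeriv n S) (deriv S s * iteratedDeriv n S t) (s + t) :=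
  hS.hasDerivAt_iteratedDeriv_of_mul (hS.iteratedDeriv_add n) hs ht

theorem iteratedDeriv_succ_add (n : ℕ) {s t : ℝ} (hs : 0 < s) (ht : 0 < t) :
    iteratedDeriv (n + 1) S (s + t) = deriv S s * iteratedDeriv n S t := by
  rw [iteratedDeriv_succ, (hS.hasDerivAt_iteratedDeriv n hs ht).deriv]

theorem iteratedDeriv_mul (n m : ℕ) : ∀ s t : ℝ, 0 < s → 0 < t →
    iteratedDeriv n S s * iteratedDeriv m S t = iteratedDeriv (n + m) S (s + t) := by
  induction n with
  | zero =>
    intro s t hs ht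
    rw [iteratedDeriv_zero, zero_add, hS.iteratedDeriv_add m s t hs ht]
  | succ n ih =>
    intro s t hs ht
    have hs2 := half_pos hs
    have e1 := hS.iteratedDeriv_succ_add n hs2 hs2
    rw [add_halves] at e1
    rw [e1, mul_assoc, ih _ _ hs2 ht, ← hS.iteratedDeriv_succ_add (n + m) hs2 (add_pos hs2 ht),
      ← add_assoc, add_halves, add_right_comm]

end IsSmoothingSemigroup

/-- `(-1)^n` times the `n`-th derivative. -/
def negDeriv (S : ℝ → 𝔸) (n : ℕ) (t : ℝ) : 𝔸 := (-1 : ℝ) ^ n • iteratedDeriv n S t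

theorem negDeriv_zero (S : ℝ → 𝔸) : negDeriv S 0 = S := by
  funext t
  simp [negDeriv]

/-- `(-A)^α S t`, where `A` is the generator of the semigroup `S`. -/
def smoothing (S : ℝ → 𝔸) (α t : ℝ) : 𝔸 :=
  if α = 0 then S t else weyl ((⌊α⌋₊ + 1 : ℕ) - α) (negDeriv S (⌊α⌋₊ + 1)) t

theorem smoothing_zero (S : ℝ → 𝔸) (t : ℝ) : smoothing S 0 t = S t := if_pos rfl

namespace IsSmoothingSemigroup

variable {S : ℝ → 𝔸} (hS : IsSmoothingSemigroup S)
include hS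

theorem hasDerivAt_negDeriv (n : ℕ) {t : ℝ} (ht : 0 < t) :
    HasDerivAt (negDeriv S n) (-negDeriv S (n + 1) t) t := by
  have h := hS.hasDerivAt_iteratedDeriv n (half_pos ht) (half_pos ht)
  rw [← hS.iteratedDeriv_succ_add n (half_pos ht) (half_pos ht), add_halves] at h
  have h2 := h.const_smul ((-1 : ℝ) ^ n)
  refine h2.congr_deriv ?_
  simp [negDeriv, pow_succ]

theorem negDeriv_mul (n m : ℕ) {s t : ℝ} (hs : 0 < s) (ht : 0 < t) :
    negDeriv S n s * negDeriv S m t = negDeriv S (n + m) (s + t) := by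
  simp only [negDeriv]
  rw [smul_mul_smul_comm, hS.iteratedDeriv_mul n m s t hs ht, pow_add]

/-- Halving the time, A^(n+1) S(t) = A S(t/2) A^n S(t/2); each step costs one factor 1/t. -/
theorem powerDecay_negDeriv (n : ℕ) : PowerDecay n (negDeriv S n) := by
  refine ⟨fun t ht => (hS.hasDerivAt_negDeriv n ht).continuousAt.continuousWithinAt, ?_⟩
  induction n with
  | zero =>
    obtain ⟨M, hM, h⟩ := hS.bounded
    exact ⟨M, hM, fun t ht => by simpa [negDeriv] using h t ht⟩
  | succ n ih =>
    obtain ⟨C, hC, h⟩ := ih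
    obtain ⟨D, hD, h'⟩ := hS.deriv_bounded
    refine ⟨(D * 2) * (C * 2 ^ (n : ℝ)), by positivity, fun t ht => ?_⟩
    have e := hS.negDeriv_mul 1 n (half_pos ht) (half_pos ht)
    rw [add_halves, add_comm 1 n] at e
    rw [← e]
    refine (norm_mul_le _ _).trans ?_
    have h1 : ‖negDeriv S 1 (t / 2)‖ ≤ (D * 2) * t ^ (-1 : ℝ) := by
      have := h' (t / 2) (half_pos ht)
      simp only [negDeriv, pow_one, iteratedDeriv_one, neg_smul, one_smul, norm_neg]
      refine this.trans_eq ?_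
      rw [Real.rpow_neg_one]
      field_simp
    have h2 : ‖negDeriv S n (t / 2)‖ ≤ (C * 2 ^ (n : ℝ)) * t ^ (-(n : ℝ)) := by
      refine (h (t / 2) (half_pos ht)).trans_eq ?_
      rw [Real.div_rpow ht.le (by norm_num), Real.rpow_neg (by norm_num : (0 : ℝ) ≤ 2)]
      field_simp
    refine (mul_le_mul h1 h2 (norm_nonneg _) (by positivity)).trans_eq ?_
    have : t ^ (-((n + 1 : ℕ) : ℝ)) = t ^ (-1 : ℝ) * t ^ (-(n : ℝ)) := by
      rw [← Real.rpow_add ht]; push_cast; ring_nf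
    rw [this]
    ring

theorem norm_smoothing_le {α : ℝ} (hα : 0 ≤ α) :
    ∃ C, 0 ≤ C ∧ ∀ t, 0 < t → ‖smoothing S α t‖ ≤ C * t ^ (-α) := by
  rcases hα.eq_or_lt with rfl | hα
  · obtain ⟨M, hM, h⟩ := hS.bounded
    exact ⟨M, hM, fun t ht => by simpa [smoothing_zero] using h t ht⟩
  · have hn := Nat.lt_floor_add_one α
    obtain ⟨C, hC, h⟩ := (hS.powerDecay_negDeriv (⌊α⌋₊ + 1)).norm_weyl_le
      (a := (⌊α⌋₊ + 1 : ℕ) - α) (by push_cast; linarith) (by linarith)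
    refine ⟨C, hC, fun t ht => ?_⟩
    rw [smoothing, if_neg hα.ne']
    simpa using h t ht

theorem mul_weyl_negDeriv (m : ℕ) {n : ℕ} {a : ℝ} (ha : 0 < a) (han : a < n) {s t : ℝ}
    (hs : 0 < s) (ht : 0 < t) :
    negDeriv S m s * weyl a (negDeriv S n) t = weyl a (negDeriv S (m + n)) (s + t) := by
  rw [weyl, weyl, mul_smul_comm]
  congr 1
  rw [← integral_const_mul_of_integrable ((hS.powerDecay_negDeriv n).integrable ha han ht)]
  refine setIntegral_congr_fun measurableSet_Ioi fun u hu => ?_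
  rw [mul_smul_comm, hS.negDeriv_mul m n hs (add_pos ht hu), add_assoc]

theorem weyl_negDeriv_mul {n : ℕ} {a : ℝ} (ha : 0 < a) (han : a < n) {s t : ℝ} (hs : 0 < s)
    {X : 𝔸} {g : ℝ → 𝔸} (h : ∀ r, 0 < r → negDeriv S n r * X = g (r + t)) :
    weyl a (negDeriv S n) s * X = weyl a g (s + t) := by
  rw [weyl, weyl, smul_mul_assoc]
  congr 1
  rw [← integral_mul_const_of_integrable ((hS.powerDecay_negDeriv n).integrable ha han hs)]
  refine setIntegral_congr_fun measurableSet_Ioi fun u hu => ?_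
  rw [smul_mul_assoc, h _ (add_pos hs hu), add_right_comm]

variable [CompleteSpace 𝔸]

/-- The fundamental theorem of calculus on a half-line; n > 0 makes the boundary term at infinity
vanish. -/
theorem weyl_one_negDeriv {n : ℕ} (hn : 0 < n) {t : ℝ} (ht : 0 < t) :
    weyl 1 (negDeriv S (n + 1)) t = negDeriv S n t := by
  have hd := hS.powerDecay_negDeriv (n + 1)
  have hi := hd.integrable one_pos (by push_cast; simpa using hn) ht
  simp only [sub_self, Real.rpow_zero, one_smul] at hi
  simp only [weyl, Real.Gamma_one, inv_one, one_smul, sub_self, Real.rpow_zero]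
  have hlim : Tendsto (fun u => -negDeriv S n (t + u)) atTop (𝓝 0) := by
    obtain ⟨-, C, hC, h⟩ := hS.powerDecay_negDeriv n
    have : Tendsto (fun u : ℝ => C * u ^ (-(n : ℝ))) atTop (𝓝 (C * 0)) :=
      (tendsto_rpow_neg_atTop (by exact_mod_cast hn)).const_mul C
    rw [mul_zero] at this
    refine squeeze_zero_norm' ?_ this
    filter_upwards [eventually_gt_atTop 0] with u hu
    rw [norm_neg]
    exact (h _ (add_pos ht hu)).trans (mul_le_mul_of_nonneg_left
      (Real.rpow_le_rpow_of_nonpos hu (by linarith) (by simp)) hC)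
  have hder : ∀ u ∈ Set.Ici (0 : ℝ),
      HasDerivAt (fun u => -negDeriv S n (t + u)) (negDeriv S (n + 1) (t + u)) u := by
    intro u hu
    have := ((hS.hasDerivAt_negDeriv n (add_pos_of_pos_of_nonneg ht hu)).comp_const_add t u).neg
    rwa [neg_neg] at this
  rw [integral_Ioi_of_hasDerivAt_of_tendsto' hder hi hlim]
  simp

theorem weyl_negDeriv_add_one {n : ℕ} {α : ℝ} (hα : 0 < α) (hn : α < n) {t : ℝ} (ht : 0 < t) :
    weyl ((n + 1 : ℕ) - α) (negDeriv S (n + 1)) t = weyl (n - α) (negDeriv S n) t := by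
  have hn0 : 0 < n := by exact_mod_cast hα.trans hn
  rw [← weyl_congr (a := n - α) ht fun s hs => hS.weyl_one_negDeriv hn0 hs,
    (hS.powerDecay_negDeriv (n + 1)).weyl_weyl (sub_pos.2 hn) one_pos (by push_cast; linarith) ht]
  congr 1
  push_cast
  ring

/-- Any integer above α may replace ⌊α⌋ + 1, because raising n by one inserts a Weyl integral of
order 1 that undoes one derivative. This gives the freedom to add exponents. -/
theorem smoothing_eq {n : ℕ} {α : ℝ} (hα : 0 < α) (hn : α < n) {t : ℝ} (ht : 0 < t) :
    smoothing S α t = weyl (n - α) (negDeriv S n) t := by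
  rw [smoothing, if_neg hα.ne']
  have key : ∀ k : ℕ, ⌊α⌋₊ + 1 ≤ k →
      weyl ((⌊α⌋₊ + 1 : ℕ) - α) (negDeriv S (⌊α⌋₊ + 1)) t = weyl (k - α) (negDeriv S k) t := by
    intro k hk
    induction k, hk using Nat.le_induction with
    | base => rfl
    | succ k hk ih =>
      rw [ih, hS.weyl_negDeriv_add_one hα (Nat.lt_of_floor_lt hk) ht]
  exact key n (Nat.floor_lt hα.le |>.2 hn)

/-- Pulling both Weyl integrals out of the product leaves an iterated Weyl integral of the
derivative of order n + m, which the composition law collapses. Exponent 0 is separate: a Weyl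
integral of order n of the n-th derivative is at the borderline of the decay. -/
theorem smoothing_mul {α β : ℝ} (hα : 0 ≤ α) (hβ : 0 ≤ β) {s t : ℝ} (hs : 0 < s) (ht : 0 < t) :
    smoothing S α s * smoothing S β t = smoothing S (α + β) (s + t) := by
  have hst := add_pos hs ht
  obtain ⟨n, hn⟩ := exists_nat_gt α
  obtain ⟨m, hm⟩ := exists_nat_gt β
  rcases hα.eq_or_lt with rfl | hα
  · rw [smoothing_zero, zero_add]
    rcases hβ.eq_or_lt with rfl | hβ
    · rw [smoothing_zero, smoothing_zero, hS.add s t hs ht]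
    · rw [hS.smoothing_eq hβ hm ht, hS.smoothing_eq hβ hm hst]
      simpa [negDeriv_zero] using
        hS.mul_weyl_negDeriv 0 (n := m) (sub_pos.2 hm) (by linarith) hs ht
  · rcases hβ.eq_or_lt with rfl | hβ
    · rw [smoothing_zero, add_zero, hS.smoothing_eq hα hn hs, hS.smoothing_eq hα hn hst]
      refine hS.weyl_negDeriv_mul (sub_pos.2 hn) (by linarith) hs fun r hr => ?_
      simpa [negDeriv_zero] using hS.negDeriv_mul n 0 hr ht
    · have hnm : α + β < (n + m : ℕ) := by push_cast; linarith
      rw [hS.smoothing_eq hα hn hs, hS.smoothing_eq hβ hm ht,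
        hS.smoothing_eq (add_pos hα hβ) hnm hst,
        hS.weyl_negDeriv_mul (sub_pos.2 hn) (by linarith) hs fun r hr =>
          hS.mul_weyl_negDeriv n (sub_pos.2 hm) (by linarith) hr ht,
        (hS.powerDecay_negDeriv (n + m)).weyl_weyl (sub_pos.2 hn) (sub_pos.2 hm)
          (by push_cast; linarith) hst]
      congr 1
      push_cast
      ring

theorem smoothing_one {t : ℝ} (ht : 0 < t) : smoothing S 1 t = -deriv S t := by
  rw [hS.smoothing_eq (n := 2) one_pos (by norm_num) ht]
  have h := hS.weyl_one_negDeriv one_pos ht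
  have e : ((2 : ℕ) : ℝ) - 1 = 1 := by norm_num
  rw [e, h]
  simp [negDeriv]

/-- Near t the function is S(x - t/2) times the constant (-A)^α S(t/2), so only S is differentiated.
-/
theorem hasDerivAt_smoothing {α : ℝ} (hα : 0 ≤ α) {t : ℝ} (ht : 0 < t) :
    HasDerivAt (smoothing S α) (-smoothing S (α + 1) t) t := by
  have ht2 := half_pos ht
  have h1 : HasDerivAt (fun x => S (x - t / 2) * smoothing S α (t / 2))
      (deriv S (t / 2) * smoothing S α (t / 2)) t := by
    refine HasDerivAt.mul_const ?_ _
    have h2 : HasDerivAt S (deriv S (t / 2)) (t - t / 2) := by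
      rw [sub_half]; exact (hS.differentiableAt _ ht2).hasDerivAt
    exact h2.comp_sub_const t (t / 2)
  have e : deriv S (t / 2) * smoothing S α (t / 2) = -smoothing S (α + 1) t := by
    have := hS.smoothing_mul zero_le_one hα ht2 ht2
    rw [hS.smoothing_one ht2, add_halves, add_comm] at this
    rw [← this, neg_mul, neg_neg]
  rw [← e]
  refine h1.congr_of_eventuallyEq ?_
  filter_upwards [lt_mem_nhds (half_lt_self ht)] with x hx
  have := hS.smoothing_mul le_rfl hα (sub_pos.2 hx) ht2
  rw [smoothing_zero, sub_add_cancel, zero_add] at this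
  exact this.symm

theorem continuousOn_smoothing {α : ℝ} (hα : 0 ≤ α) :
    ContinuousOn (smoothing S α) (Set.Ioi 0) :=
  fun _ ht => (hS.hasDerivAt_smoothing hα ht).continuousAt.continuousWithinAt

theorem powerDecay_smoothing {α : ℝ} (hα : 0 ≤ α) : PowerDecay α (smoothing S α) :=
  ⟨hS.continuousOn_smoothing hα, hS.norm_smoothing_le hα⟩

theorem smoothing_eq_weyl_smoothing {σ ρ : ℝ} (hσ : 0 < σ) (hσρ : σ < ρ) {t : ℝ} (ht : 0 < t) :
    smoothing S σ t = weyl (ρ - σ) (smoothing S ρ) t := by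
  obtain ⟨n, hn⟩ := exists_nat_gt ρ
  rw [hS.smoothing_eq hσ (hσρ.trans hn) ht,
    weyl_congr (a := ρ - σ) ht fun s hs => hS.smoothing_eq (hσ.trans hσρ) hn hs,
    (hS.powerDecay_negDeriv n).weyl_weyl (sub_pos.2 hσρ) (sub_pos.2 hn) (by linarith) ht]
  congr 1
  ring

end IsSmoothingSemigroup
end BanachAlgebra

/-! ### Hölder exponents, partitions and Hölder paths -/

/-- The Hölder exponent is shared: h^κ measures smallness, r^(η - κ) is kept to weaken the
singularity of the kernel. -/
theorem rpow_le_rpow_mul_rpow {a h r η κ : ℝ} (ha : 0 ≤ a) (hah : a ≤ h) (har : a ≤ r)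
    (hκ : 0 ≤ κ) (hκη : κ ≤ η) : a ^ η ≤ h ^ κ * r ^ (η - κ) := by
  have h1 : a ^ η = a ^ κ * a ^ (η - κ) := by
    rw [← Real.rpow_add_of_nonneg ha hκ (sub_nonneg.2 hκη), add_sub_cancel]
  rw [h1]
  exact mul_le_mul (Real.rpow_le_rpow ha hah hκ) (Real.rpow_le_rpow ha har (sub_nonneg.2 hκη))
    (Real.rpow_nonneg ha _) (Real.rpow_nonneg (ha.trans hah) _)

namespace TimePartition

variable {t : ℝ} (π : TimePartition t)

theorem pt_le_pt {k j : ℕ} (hkj : k ≤ j) (hj : j ≤ π.m) : π.pt k ≤ π.pt j := by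
  induction j, hkj using Nat.le_induction with
  | base => exact le_rfl
  | succ j _ ih => exact (ih (by omega)).trans (π.pt_lt j (by omega)).le

theorem pt_nonneg {k : ℕ} (hk : k ≤ π.m) : 0 ≤ π.pt k :=
  π.pt_zero ▸ π.pt_le_pt (Nat.zero_le k) hk

theorem pt_le {k : ℕ} (hk : k ≤ π.m) : π.pt k ≤ t :=
  (π.pt_le_pt hk le_rfl).trans_eq π.pt_last

theorem pt_lt_last {k : ℕ} (hk : k < π.m) : π.pt k < t :=
  (π.pt_lt k hk).trans_le (π.pt_le hk)

theorem sub_le_mesh {k : ℕ} (hk : k < π.m) : π.pt (k + 1) - π.pt k ≤ π.mesh :=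
  le_ciSup (f := fun k : Fin π.m => π.pt (k + 1) - π.pt k) (Set.finite_range _).bddAbove ⟨k, hk⟩

end TimePartition

/-- The path is `η`-Hölder continuous on `[0, T]` with constant `L`. -/
def IsHolderPath {X : Type*} [NormedAddCommGroup X] (N : ℝ → X) (T L η : ℝ) : Prop :=
  ∀ s ∈ Set.Icc 0 T, ∀ t ∈ Set.Icc 0 T, ‖N s - N t‖ ≤ L * |s - t| ^ η

theorem IsHolderPath.continuousOn {X : Type*} [NormedAddCommGroup X] {N : ℝ → X} {T L η : ℝ}
    (hN : IsHolderPath N T L η) (hη : 0 < η) : ContinuousOn N (Set.Icc 0 T) := by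
  intro t ht
  rw [ContinuousWithinAt, tendsto_iff_norm_sub_tendsto_zero]
  have h : ContinuousWithinAt (fun s => L * |s - t| ^ η) (Set.Icc 0 T) t :=
    ContinuousAt.continuousWithinAt (((continuous_abs.comp
      (continuous_id.sub continuous_const)).continuousAt.rpow_const (Or.inr hη.le)).const_mul L)
  have h0 : Tendsto (fun s => L * |s - t| ^ η) (𝓝[Set.Icc 0 T] t) (𝓝 0) := by
    have := h.tendsto
    simpa [Real.zero_rpow hη.ne'] using this
  refine squeeze_zero' (Eventually.of_forall fun s => norm_nonneg _) ?_ h0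
  filter_upwards [self_mem_nhdsWithin] with s hs using hN s hs t ht

/-! ### Convolution of a Hölder path with a singular kernel -/

section Kernel

variable {X W : Type*} [NormedAddCommGroup X] [NormedSpace ℂ X] [NormedAddCommGroup W]
  [NormedSpace ℂ W]

/-- A kernel `K` on `(0, ∞)`, strongly differentiable, whose derivative `K'` is norm continuous and
`O(u ^ (-1 - ν))` on `(0, T]`. -/
structure IsSingularKernel (K K' : ℝ → X →L[ℂ] W) (T C ν : ℝ) : Prop where
  hasDerivAt : ∀ u, 0 < u → ∀ x, HasDerivAt (fun v => K v x) (K' u x) u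
  continuousOn : ContinuousOn K' (Set.Ioi 0)
  nonneg : 0 ≤ C
  bound : ∀ u, 0 < u → u ≤ T → ‖K' u‖ ≤ C * u ^ (-1 - ν)

/-- `K(t) N(t) + ∫₀ᵗ K'(t - s) (N(s) - N(t)) ds`. -/
def kernelConvolution (K K' : ℝ → X →L[ℂ] W) (N : ℝ → X) (t : ℝ) : W :=
  K t (N t) + ∫ s in (0 : ℝ)..t, K' (t - s) (N s - N t)

theorem IsSingularKernel.norm_apply_le {K K' : ℝ → X →L[ℂ] W} {T C ν : ℝ}
    (hK : IsSingularKernel K K' T C ν) {r D p : ℝ} (hr : 0 < r) (hrT : r ≤ T) {x : X}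
    (hx : ‖x‖ ≤ D * r ^ p) : ‖K' r x‖ ≤ C * D * r ^ (p - 1 - ν) := by
  refine ((K' r).le_opNorm x).trans ((mul_le_mul (hK.bound r hr hrT) hx (norm_nonneg _)
    (mul_nonneg hK.nonneg (Real.rpow_nonneg hr.le _))).trans_eq ?_)
  have : r ^ (p - 1 - ν) = r ^ (-1 - ν) * r ^ p := by rw [← Real.rpow_add hr]; ring_nf
  rw [this]
  ring

theorem intervalIntegrable_sub_rpow {p t a b : ℝ} (hp : -1 < p) :
    IntervalIntegrable (fun s => (t - s) ^ p) volume a b := by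
  have := (intervalIntegral.intervalIntegrable_rpow' hp (a := t - a) (b := t - b)).comp_sub_left t
  simpa using this

section

variable {K K' : ℝ → X →L[ℂ] W} {N : ℝ → X} {T C ν L η κ : ℝ}
  (hK : IsSingularKernel K K' T C ν) (hN : IsHolderPath N T L η)
include hK hN

theorem continuousOn_kernel_integrand (hη : 0 < η) {t : ℝ} (htT : t ≤ T) (c : X) :
    ContinuousOn (fun s => K' (t - s) (N s - c)) (Set.Ico 0 t) := by
  refine ContinuousOn.clm_apply (hK.continuousOn.comp (by fun_prop) fun s hs => ?_) ?_
  · exact sub_pos.2 hs.2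
  · exact ((hN.continuousOn hη).mono fun s hs => ⟨hs.1, hs.2.le.trans htT⟩).sub continuousOn_const

theorem norm_kernel_increment_le (hL : 0 ≤ L) (hκ : 0 < κ) (hκη : κ ≤ η) {s b t h : ℝ} (hs : 0 ≤ s)
    (hsb : s ≤ b) (hbt : b ≤ t) (hst : s < t) (htT : t ≤ T) (hh : b - s ≤ h) :
    ‖K' (t - s) (N b - N s)‖ ≤ C * (L * h ^ κ) * (t - s) ^ (η - κ - 1 - ν) := by
  refine hK.norm_apply_le (sub_pos.2 hst) (by linarith) ?_
  refine (hN b ⟨hs.trans hsb, hbt.trans htT⟩ s ⟨hs, hsb.trans (hbt.trans htT)⟩).trans ?_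
  rw [abs_of_nonneg (sub_nonneg.2 hsb), mul_assoc]
  exact mul_le_mul_of_nonneg_left (rpow_le_rpow_mul_rpow (sub_nonneg.2 hsb) hh
    (by linarith) hκ.le hκη) hL

variable (hL : 0 ≤ L) (hη : 0 < η) (hκ : 0 < κ) (hκη : κ ≤ η) (hκν : κ < η - ν)
include hL hη hκ hκη hκν

theorem integrableOn_kernel_integrand {t : ℝ} (htT : t ≤ T) :
    IntegrableOn (fun s => K' (t - s) (N s - N t)) (Set.Ioc 0 t) := by
  rcases le_or_gt t 0 with ht | ht
  · simp [Set.Ioc_eq_empty_of_le ht]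
  rw [integrableOn_Ioc_iff_integrableOn_Ioo]
  have hp : -1 < η - κ - 1 - ν := by linarith
  have hi : IntegrableOn (fun s => C * (L * t ^ κ) * (t - s) ^ (η - κ - 1 - ν)) (Set.Ioo 0 t) :=
    (((intervalIntegrable_iff_integrableOn_Ioc_of_le
      ht.le).1 (intervalIntegrable_sub_rpow hp)).mono_set Set.Ioo_subset_Ioc_self).const_mul _
  refine hi.mono' (((continuousOn_kernel_integrand hK hN hη htT (N t)).mono
    Set.Ioo_subset_Ico_self).aestronglyMeasurable measurableSet_Ioo) ?_
  refine (ae_restrict_iff' measurableSet_Ioo).2 (Eventually.of_forall fun s hs => ?_)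
  rw [← neg_sub (N t), map_neg, norm_neg]
  exact norm_kernel_increment_le hK hN hL hκ hκη hs.1.le hs.2.le le_rfl hs.2 htT
    (by linarith [hs.1])

variable [CompleteSpace W]

/-- On a fixed vector the increment of K is the integral of K'(t - s); the error comes from N(b) -
N(s) alone, whose size is at most L times both h^κ and (t - s)^(η - κ). -/
theorem norm_kernel_step_sub_integral_le {a b t h : ℝ} (ha : 0 ≤ a) (hab : a < b) (hbt : b ≤ t)
    (htT : t ≤ T) (hh : b - a ≤ h) :
    ‖(K (t - a) (N b - N t) - K (t - b) (N b - N t)) -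
        ∫ s in a..b, K' (t - s) (N s - N t)‖ ≤
      C * (L * h ^ κ) * ∫ s in a..b, (t - s) ^ (η - κ - 1 - ν) := by
  have hp : -1 < η - κ - 1 - ν := by linarith
  have hg : IntervalIntegrable (fun s => K' (t - s) (N s - N t)) volume a b :=
    (intervalIntegrable_iff_integrableOn_Ioc_of_le hab.le).2
      ((integrableOn_kernel_integrand hK hN hL hη hκ hκη hκν htT).mono_set
        (Set.Ioc_subset_Ioc ha hbt))
  have key : IntervalIntegrable (fun s => K' (t - s) (N b - N t)) volume a b ∧
      K (t - a) (N b - N t) - K (t - b) (N b - N t) =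
        ∫ s in a..b, K' (t - s) (N b - N t) := by
    -- In the last interval, b = t, the vector N(b) - N(t) is zero, so the singularity of the kernel
    -- is harmless.
    rcases hbt.eq_or_lt with rfl | hbt
    · simp
    · have hi : IntervalIntegrable (fun s => K' (t - s) (N b - N t)) volume a b := by
        refine ContinuousOn.intervalIntegrable ?_
        rw [Set.uIcc_of_le hab.le]
        refine ContinuousOn.clm_apply (hK.continuousOn.comp (by fun_prop) fun s hs => ?_)
          continuousOn_const
        exact sub_pos.2 (hs.2.trans_lt hbt)
      refine ⟨hi, ?_⟩
      have hd : ∀ s ∈ Set.uIcc a b, HasDerivAt (fun s => -K (t - s) (N b - N t))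
          (K' (t - s) (N b - N t)) s := by
        intro s hs
        rw [Set.uIcc_of_le hab.le] at hs
        have := ((hK.hasDerivAt (t - s) (sub_pos.2 (hs.2.trans_lt hbt)) (N b - N t)).comp_const_sub
          t s).neg
        rwa [neg_neg] at this
      rw [intervalIntegral.integral_eq_sub_of_hasDerivAt hd hi]
      abel
  rw [key.2, ← intervalIntegral.integral_sub key.1 hg, ← intervalIntegral.integral_const_mul]
  refine intervalIntegral.norm_integral_le_of_norm_le hab.le ?_
    ((intervalIntegrable_sub_rpow hp).const_mul _)
  have hne : ∀ᵐ s : ℝ, s ≠ t := by simp [ae_iff]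
  filter_upwards [hne] with s hst hs
  rw [← map_sub, sub_sub_sub_cancel_right]
  exact norm_kernel_increment_le hK hN hL hκ hκη (ha.trans hs.1.le) hs.2 hbt
    (lt_of_le_of_ne (hs.2.trans hbt) hst) htT (by linarith [hs.1])

/-- Summation by parts reduces the sum to the one-step errors, whose bounds add up to one integral
over [0, t]. -/
theorem norm_kernel_riemann_sum_sub_le (hN0 : N 0 = 0) {t : ℝ} (htT : t ≤ T)
    (π : TimePartition t) :
    ‖(∑ k ∈ Finset.range π.m, K (t - π.pt k) (N (π.pt (k + 1)) - N (π.pt k))) -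
        kernelConvolution K K' N t‖ ≤
      C * (L * π.mesh ^ κ) * ∫ s in (0 : ℝ)..t, (t - s) ^ (η - κ - 1 - ν) := by
  have hp : -1 < η - κ - 1 - ν := by linarith
  have e1 : ∫ s in (0 : ℝ)..t, K' (t - s) (N s - N t) =
      ∑ k ∈ Finset.range π.m, ∫ s in π.pt k..π.pt (k + 1), K' (t - s) (N s - N t) := by
    rw [intervalIntegral.sum_integral_adjacent_intervals, π.pt_zero, π.pt_last]
    intro k hk
    exact (intervalIntegrable_iff_integrableOn_Ioc_of_le (π.pt_lt k hk).le).2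
      ((integrableOn_kernel_integrand hK hN hL hη hκ hκη hκν htT).mono_set
        (Set.Ioc_subset_Ioc (π.pt_nonneg hk.le) (π.pt_le hk)))
  have e2 : ∫ s in (0 : ℝ)..t, (t - s) ^ (η - κ - 1 - ν) =
      ∑ k ∈ Finset.range π.m, ∫ s in π.pt k..π.pt (k + 1), (t - s) ^ (η - κ - 1 - ν) := by
    rw [intervalIntegral.sum_integral_adjacent_intervals, π.pt_zero, π.pt_last]
    exact fun k _ => intervalIntegrable_sub_rpow hp
  -- The telescoping sum has end terms K(0)(N(t) - N(t)) = 0, whatever K(0) is, and -K(t)(N(0) -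
  -- N(t)).
  have e3 : K t (N t) = ∑ k ∈ Finset.range π.m, (K (t - π.pt (k + 1)) (N (π.pt (k + 1)) - N t) -
      K (t - π.pt k) (N (π.pt k) - N t)) := by
    rw [Finset.sum_range_sub fun k => K (t - π.pt k) (N (π.pt k) - N t), π.pt_zero, π.pt_last, hN0]
    simp
  rw [kernelConvolution, e1, e2, e3, ← Finset.sum_add_distrib, ← Finset.sum_sub_distrib,
    Finset.mul_sum]
  refine norm_sum_le_of_le _ fun k hk => ?_
  have hk := Finset.mem_range.1 hk
  convert! norm_kernel_step_sub_integral_le hK hN hL hη hκ hκη hκν (π.pt_nonneg hk.le)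
    (π.pt_lt k hk) (π.pt_le hk) htT (π.sub_le_mesh hk) using 2
  simp only [map_sub]
  abel

/-- With r = t - s and N extended by 0 to negative times, the domain [0, T] and the kernel no longer
depend on t, so values at two times can be subtracted. The added piece over [t, T] is the increment
of K on -N(t), which trades K(t) for K(T). -/
theorem kernelConvolution_eq (hN0 : N 0 = 0) (hT : 0 < T) {t : ℝ} (ht : t ∈ Set.Icc 0 T) :
    IntervalIntegrable (fun r => K' r (N (max (t - r) 0) - N t)) volume 0 T ∧
      kernelConvolution K K' N t =
        K T (N t) + ∫ r in (0 : ℝ)..T, K' r (N (max (t - r) 0) - N t) := by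
  have hp : -1 < η - κ - 1 - ν := by linarith
  have hi : IntervalIntegrable (fun r => K' r (N (max (t - r) 0) - N t)) volume 0 T := by
    rw [intervalIntegrable_iff_integrableOn_Ioc_of_le hT.le]
    have hd : IntegrableOn (fun r => C * (L * T ^ κ) * r ^ (η - κ - 1 - ν)) (Set.Ioc 0 T) :=
      ((intervalIntegrable_iff_integrableOn_Ioc_of_le hT.le).1
        (intervalIntegral.intervalIntegrable_rpow' hp)).const_mul _
    have hmem : ∀ r ∈ Set.Ioc 0 T, max (t - r) 0 ∈ Set.Icc 0 T := fun r hr =>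
      ⟨le_max_right _ _, max_le (by linarith [hr.1, ht.2]) hT.le⟩
    refine hd.mono' (ContinuousOn.aestronglyMeasurable ?_ measurableSet_Ioc)
      ((ae_restrict_iff' measurableSet_Ioc).2 (Eventually.of_forall fun r hr => ?_))
    · refine ContinuousOn.clm_apply (hK.continuousOn.mono fun r hr => hr.1)
        (ContinuousOn.sub ?_ continuousOn_const)
      exact (hN.continuousOn hη).comp (by fun_prop) hmem
    · refine hK.norm_apply_le hr.1 hr.2 ((hN _ (hmem r hr) t ht).trans ?_)
      rw [mul_assoc]
      have h1 : |max (t - r) 0 - t| ≤ r := by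
        rw [abs_le]
        constructor
        · linarith [le_max_left (t - r) 0]
        · linarith [max_le (a := t - r) (b := 0) (c := t + r) (by linarith [hr.1])
            (by linarith [hr.1, ht.1])]
      exact mul_le_mul_of_nonneg_left
        (rpow_le_rpow_mul_rpow (abs_nonneg _) (h1.trans hr.2) h1 hκ.le hκη) hL
  refine ⟨hi, ?_⟩
  rw [kernelConvolution]
  -- The fundamental theorem on [t, T] needs t > 0, as nothing is known of K at 0; for t = 0
  -- everything vanishes.
  rcases ht.1.eq_or_lt with rfl | ht0
  · simp only [hN0, map_zero, intervalIntegral.integral_same]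
    rw [intervalIntegral.integral_congr (g := fun _ => (0 : W)), intervalIntegral.integral_zero]
    intro r hr
    rw [Set.uIcc_of_le hT.le] at hr
    simp only
    rw [max_eq_right (show 0 - r ≤ 0 by linarith [hr.1]), hN0, sub_zero, map_zero]
  have hsub1 : Set.uIcc 0 t ⊆ Set.uIcc 0 T := by
    rw [Set.uIcc_of_le ht0.le, Set.uIcc_of_le hT.le]; exact Set.Icc_subset_Icc_right ht.2
  have hsub2 : Set.uIcc t T ⊆ Set.uIcc 0 T := by
    rw [Set.uIcc_of_le ht.2, Set.uIcc_of_le hT.le]; exact Set.Icc_subset_Icc_left ht.1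
  rw [← intervalIntegral.integral_add_adjacent_intervals (hi.mono_set hsub1) (hi.mono_set hsub2)]
  have e1 : ∫ r in (0 : ℝ)..t, K' r (N (max (t - r) 0) - N t) =
      ∫ s in (0 : ℝ)..t, K' (t - s) (N s - N t) := by
    have := intervalIntegral.integral_comp_sub_left (a := 0) (b := t)
      (fun r => K' r (N (max (t - r) 0) - N t)) t
    simp only [sub_self, sub_zero] at this
    rw [← this]
    refine intervalIntegral.integral_congr fun s hs => ?_
    rw [Set.uIcc_of_le ht0.le] at hs
    simp [hs.1]
  have heq : Set.EqOn (fun r => K' r (N (max (t - r) 0) - N t)) (fun r => K' r (-N t))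
      (Set.uIcc t T) := by
    intro r hr
    rw [Set.uIcc_of_le ht.2] at hr
    simp [max_eq_right (sub_nonpos.2 hr.1), hN0]
  have e2 : ∫ r in t..T, K' r (N (max (t - r) 0) - N t) = K T (-N t) - K t (-N t) := by
    rw [intervalIntegral.integral_congr heq]
    refine intervalIntegral.integral_eq_sub_of_hasDerivAt (f := fun r => K r (-N t)) ?_ ?_
    · intro r hr
      rw [Set.uIcc_of_le ht.2] at hr
      exact hK.hasDerivAt r (ht0.trans_le hr.1) _
    · exact (intervalIntegrable_congr (heq.mono Set.uIoc_subset_uIcc)).1 (hi.mono_set hsub2)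
  rw [e1, e2]
  simp only [map_neg]
  abel

theorem exists_norm_kernelConvolution_sub_le (hN0 : N 0 = 0) (hT : 0 < T) :
    ∃ D, 0 ≤ D ∧ ∀ s ∈ Set.Icc 0 T, ∀ t ∈ Set.Icc 0 T,
      ‖kernelConvolution K K' N s - kernelConvolution K K' N t‖ ≤ D * |s - t| ^ κ := by
  have hp : -1 < η - κ - 1 - ν := by linarith
  have hI : 0 ≤ ∫ r in (0 : ℝ)..T, r ^ (η - κ - 1 - ν) :=
    intervalIntegral.integral_nonneg hT.le fun r hr => Real.rpow_nonneg hr.1 _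
  have hC := hK.nonneg
  refine ⟨‖K T‖ * (L * T ^ (η - κ)) +
    C * (2 * L) * ∫ r in (0 : ℝ)..T, r ^ (η - κ - 1 - ν), by positivity, fun s hs t ht => ?_⟩
  obtain ⟨is, es⟩ := kernelConvolution_eq hK hN hL hη hκ hκη hκν hN0 hT hs
  obtain ⟨it, et⟩ := kernelConvolution_eq hK hN hL hη hκ hκη hκν hN0 hT ht
  rw [es, et, add_sub_add_comm, ← map_sub, ← intervalIntegral.integral_sub is it, add_mul]
  set h := |s - t| with hh
  have hh0 : 0 ≤ h := abs_nonneg _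
  refine (norm_add_le _ _).trans (add_le_add ?_ ?_)
  · refine ((K T).le_opNorm _).trans ?_
    rw [mul_assoc]
    refine mul_le_mul_of_nonneg_left ((hN s hs t ht).trans ?_) (norm_nonneg _)
    rw [mul_assoc, mul_comm (T ^ (η - κ))]
    refine mul_le_mul_of_nonneg_left (rpow_le_rpow_mul_rpow hh0 le_rfl ?_ hκ.le hκη) hL
    rw [abs_le]
    constructor <;> linarith [hs.1, hs.2, ht.1, ht.2]
  · have e : C * (2 * L) * (∫ r in (0 : ℝ)..T, r ^ (η - κ - 1 - ν)) * h ^ κ =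
        ∫ r in (0 : ℝ)..T, C * (2 * L * h ^ κ) * r ^ (η - κ - 1 - ν) := by
      rw [intervalIntegral.integral_const_mul]; ring
    rw [e]
    refine intervalIntegral.norm_integral_le_of_norm_le hT.le (Eventually.of_forall fun r hr => ?_)
      ((intervalIntegral.intervalIntegrable_rpow' hp).const_mul _)
    rw [← map_sub]
    refine hK.norm_apply_le hr.1 hr.2 ?_
    have hmem : ∀ u ∈ Set.Icc 0 T, max (u - r) 0 ∈ Set.Icc 0 T := fun u hu =>
      ⟨le_max_right _ _, max_le (by linarith [hr.1, hu.2]) hT.le⟩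
    have hclose : ∀ u ∈ Set.Icc 0 T, |max (u - r) 0 - u| ≤ r := by
      intro u hu
      rw [abs_le]
      constructor
      · linarith [le_max_left (u - r) 0]
      · linarith [max_le (a := u - r) (b := 0) (c := u + r) (by linarith [hr.1])
          (by linarith [hr.1, hu.1])]
    have hmax : |max (s - r) 0 - max (t - r) 0| ≤ h := by
      refine (abs_max_sub_max_le_max _ _ _ _).trans ?_
      simp [hh]
    -- For h ≤ r compare the times s and t; for r ≤ h compare each time with its shift by r. Either
    -- way the bound is 2 L h^κ r^(η - κ).
    rcases le_total h r with hhr | hrh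
    · have e1 : N (max (s - r) 0) - N s - (N (max (t - r) 0) - N t) =
          (N (max (s - r) 0) - N (max (t - r) 0)) - (N s - N t) := by abel
      have b1 : L * |max (s - r) 0 - max (t - r) 0| ^ η ≤ L * (h ^ κ * r ^ (η - κ)) :=
        mul_le_mul_of_nonneg_left (rpow_le_rpow_mul_rpow (abs_nonneg _) hmax (hmax.trans hhr)
          hκ.le hκη) hL
      have b2 : L * |s - t| ^ η ≤ L * (h ^ κ * r ^ (η - κ)) :=
        mul_le_mul_of_nonneg_left (rpow_le_rpow_mul_rpow hh0 le_rfl hhr hκ.le hκη) hL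
      rw [e1]
      refine (norm_sub_le _ _).trans ((add_le_add ((hN _ (hmem s hs) _ (hmem t ht)).trans b1)
        ((hN s hs t ht).trans b2)).trans_eq ?_)
      ring
    · have b : ∀ u ∈ Set.Icc 0 T,
          L * |max (u - r) 0 - u| ^ η ≤ L * (h ^ κ * r ^ (η - κ)) := fun u hu =>
        mul_le_mul_of_nonneg_left (rpow_le_rpow_mul_rpow (abs_nonneg _) ((hclose u hu).trans hrh)
          (hclose u hu) hκ.le hκη) hL
      refine (norm_sub_le _ _).trans ((add_le_add ((hN _ (hmem s hs) _ hs).trans (b s hs))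
        ((hN _ (hmem t ht) _ ht).trans (b t ht))).trans_eq ?_)
      ring

end

end Kernel

/-! ### Bounded analytic semigroups and graphs of fractional powers -/

section

variable {B : Type u} [NormedAddCommGroup B] [NormedSpace ℂ B]

/-- The sector is invariant under positive dilations, so one ball around 1 suffices. -/
theorem exists_closedBall_subset_sector {θ : ℝ} (hθ : 0 < θ) :
    ∃ ε : ℝ, 0 < ε ∧ ∀ t : ℝ, 0 < t →
      Metric.closedBall (t : ℂ) (t * ε) ⊆ {z : ℂ | z ≠ 0 ∧ |z.arg| < θ} := by
  have h1 : ∀ᶠ z : ℂ in 𝓝 1, z ≠ 0 ∧ |z.arg| < θ := by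
    refine (eventually_ne_nhds one_ne_zero).and ?_
    have := (Complex.continuousAt_arg Complex.one_mem_slitPlane).abs
    refine this.eventually_lt continuousAt_const ?_
    simpa using hθ
  obtain ⟨ε, hε, h⟩ := Metric.nhds_basis_closedBall.eventually_iff.1 h1
  refine ⟨ε, hε, fun t ht z hz => ?_⟩
  have htc : (t : ℂ) ≠ 0 := by exact_mod_cast ht.ne'
  have hz' : z / t ∈ Metric.closedBall (1 : ℂ) ε := by
    rw [mem_closedBall_iff_norm] at hz ⊢
    rw [div_sub_one htc, norm_div, Complex.norm_real, Real.norm_of_nonneg ht.le,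
      div_le_iff₀ ht, mul_comm]
    exact hz
  have e : z = (t : ℂ) * (z / t) := by field_simp
  have := h hz'
  rw [Set.mem_ofPred_eq, e, Complex.arg_real_mul _ ht]
  exact ⟨mul_ne_zero htc this.1, this.2⟩

/-- Cauchy's estimate on the circle of radius tε inside the sector bounds S'(t) by M / (tε). -/
theorem IsBoundedAnalyticSemigroup.isSmoothingSemigroup [CompleteSpace B] {S : ℝ → B →L[ℂ] B}
    (hS : IsBoundedAnalyticSemigroup S) : IsSmoothingSemigroup S := by
  obtain ⟨θ, hθ, -, U, hU, hUS, M, hM⟩ := hS.analytic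
  obtain ⟨ε, hε, hsub⟩ := exists_closedBall_subset_sector hθ
  have hmem : ∀ t : ℝ, 0 < t → (t : ℂ) ∈ {z : ℂ | z ≠ 0 ∧ |z.arg| < θ} := fun t ht =>
    hsub t ht (Metric.mem_closedBall_self (by positivity))
  have hd : ∀ t : ℝ, 0 < t → HasDerivAt S (deriv U t) t := by
    intro t ht
    have h1 : DifferentiableAt ℂ U t := hU.differentiableAt
      (mem_of_superset (Metric.closedBall_mem_nhds _ (by positivity)) (hsub t ht))
    have h2 := h1.hasDerivAt.scomp t Complex.ofRealCLM.hasDerivAt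
    simp only [Complex.ofRealCLM_apply, Complex.ofReal_one, one_smul] at h2
    refine h2.congr_of_eventuallyEq ?_
    filter_upwards [lt_mem_nhds ht] with s hs
    exact (hUS s hs).symm
  have hM0 : 0 ≤ M := (norm_nonneg _).trans (hM 1 one_ne_zero (by simpa using hθ))
  refine ⟨fun s t hs ht => hS.add s t hs.le ht.le, fun t ht => (hd t ht).differentiableAt,
    ⟨M, hM0, fun t ht => ?_⟩, ⟨M / ε, by positivity, fun t ht => ?_⟩⟩
  · rw [← hUS t ht]
    exact hM _ (hmem t ht).1 (hmem t ht).2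
  · rw [(hd t ht).deriv]
    have := Complex.norm_deriv_le_of_forall_mem_sphere_norm_le (mul_pos ht hε)
      (hU.diffContOnCl_ball (hsub t ht)) fun z hz =>
        hM z (hsub t ht (Metric.sphere_subset_closedBall hz)).1
          (hsub t ht (Metric.sphere_subset_closedBall hz)).2
    refine this.trans_eq ?_
    field_simp

theorem fracPowSemigroup_eq_smoothing (S : ℝ → B →L[ℂ] B) {α : ℝ} (hα : 0 < α) :
    fracPowSemigroup S α = smoothing S α := by
  funext t
  rw [smoothing, if_neg hα.ne']
  rfl

theorem mem_graph_generator (S : ℝ → B →L[ℂ] B) (x y : B) : (x, y) ∈ (generator S).graph ↔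
    Tendsto (fun h : ℝ => (h : ℂ)⁻¹ • (S h x - x)) (𝓝[>] 0) (𝓝 y) := by
  rw [generator, mem_graph_limitOp]
  simp

theorem HasDerivAt.apply_clm {f : ℝ → B →L[ℂ] B} {f' : B →L[ℂ] B} {t : ℝ}
    (h : HasDerivAt f f' t) (x : B) : HasDerivAt (fun s => f s x) (f' x) t :=
  ((ContinuousLinearMap.apply ℂ B x).restrictScalars ℝ).hasFDerivAt.comp_hasDerivAt t h

namespace IsBoundedAnalyticSemigroup

variable {S : ℝ → B →L[ℂ] B} (hS : IsBoundedAnalyticSemigroup S)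
include hS

theorem tendsto_zero (x : B) : Tendsto (fun t => S t x) (𝓝[>] 0) (𝓝 x) := by
  have := (hS.continuous x 0 Set.self_mem_Ici).tendsto
  rw [hS.zero] at this
  exact this.mono_left (nhdsWithin_mono _ Set.Ioi_subset_Ici_self)

theorem eq_zero_of_forall {x : B} (h : ∀ t, 0 < t → S t x = 0) : x = 0 := by
  refine tendsto_nhds_unique (hS.tendsto_zero x) (tendsto_const_nhds.congr' ?_)
  filter_upwards [self_mem_nhdsWithin] with t ht using (h t ht).symm

variable [CompleteSpace B]

theorem smoothing_apply_smoothing {α β : ℝ} (hα : 0 ≤ α) (hβ : 0 ≤ β) {s t : ℝ} (hs : 0 < s)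
    (ht : 0 < t) (x : B) :
    smoothing S α s (smoothing S β t x) = smoothing S (α + β) (s + t) x := by
  rw [← hS.isSmoothingSemigroup.smoothing_mul hα hβ hs ht]
  rfl

theorem apply_smoothing {β : ℝ} (hβ : 0 ≤ β) {s t : ℝ} (hs : 0 < s)
    (ht : 0 < t) (x : B) : S s (smoothing S β t x) = smoothing S β (s + t) x := by
  have := hS.smoothing_apply_smoothing le_rfl hβ hs ht x
  rwa [smoothing_zero, zero_add] at this

theorem smoothing_apply {β : ℝ} (hβ : 0 ≤ β) {s t : ℝ} (hs : 0 < s)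
    (ht : 0 < t) (x : B) : smoothing S β s (S t x) = smoothing S β (s + t) x := by
  have := hS.smoothing_apply_smoothing hβ le_rfl hs ht x
  rwa [smoothing_zero, add_zero] at this

theorem hasDerivAt_smoothing_apply {α : ℝ} (hα : 0 ≤ α) {t : ℝ} (ht : 0 < t) (x : B) :
    HasDerivAt (fun s => smoothing S α s x) (-smoothing S (α + 1) t x) t :=
  HasDerivAt.apply_clm (hS.isSmoothingSemigroup.hasDerivAt_smoothing hα ht) x

theorem smoothing_mem_graph_generator {α : ℝ} (hα : 0 ≤ α) {t : ℝ} (ht : 0 < t) (x : B) :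
    (smoothing S α t x, -smoothing S (α + 1) t x) ∈ (generator S).graph := by
  rw [mem_graph_generator]
  refine (hS.hasDerivAt_smoothing_apply hα ht x).tendsto_slope_zero_right.congr' ?_
  filter_upwards [self_mem_nhdsWithin] with h hh
  rw [hS.apply_smoothing hα hh ht, add_comm h, ← Complex.ofReal_inv, Complex.coe_smul]

/-- Apply S(t) to the defining limit and use continuity at t; conversely S(t) y tends to y. The
limit is thus replaced by linear equations with bounded operators. -/
theorem mem_graph_limitOp_fracPowSemigroup {α : ℝ} (hα : 0 < α) (x y : B) :
    (x, y) ∈ (limitOp (fracPowSemigroup S α)).graph ↔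
      ∀ t, 0 < t → smoothing S α t x = S t y := by
  rw [mem_graph_limitOp, fracPowSemigroup_eq_smoothing S hα]
  constructor
  · intro h t ht
    have h1 : Tendsto (fun s => S t (smoothing S α s x)) (𝓝[>] 0) (𝓝 (S t y)) :=
      ((S t).continuous.tendsto y).comp h
    have h2 : Tendsto (fun s => smoothing S α (t + s) x) (𝓝[>] 0) (𝓝 (smoothing S α t x)) := by
      have hc : ContinuousAt (fun s => smoothing S α (t + s) x) 0 := by
        have := (hS.hasDerivAt_smoothing_apply hα.le ht x).continuousAt
        rw [← add_zero t] at this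
        exact ContinuousAt.comp (f := fun s : ℝ => t + s) this (by fun_prop)
      have := hc.tendsto.mono_left (nhdsWithin_le_nhds (s := Set.Ioi 0))
      rwa [add_zero] at this
    refine tendsto_nhds_unique h2 (h1.congr' ?_)
    filter_upwards [self_mem_nhdsWithin] with s hs
    exact hS.apply_smoothing hα.le ht hs x
  · intro h
    refine (hS.tendsto_zero y).congr' ?_
    filter_upwards [self_mem_nhdsWithin] with t ht using (h t ht).symm

theorem mem_graph_fracPow_of_pos {α : ℝ} (hα : 0 < α) (x y : B) :
    (x, y) ∈ (fracPow S α).graph ↔ ∀ t, 0 < t → smoothing S α t x = S t y := by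
  rw [fracPow, if_pos hα, hS.mem_graph_limitOp_fracPowSemigroup hα]

theorem smoothing_mem_graph_fracPow {α β : ℝ} (hα : 0 < α) (hβ : 0 ≤ β) {t : ℝ} (ht : 0 < t)
    (x : B) : (smoothing S β t x, smoothing S (β + α) t x) ∈ (fracPow S α).graph := by
  rw [hS.mem_graph_fracPow_of_pos hα]
  intro s hs
  rw [hS.smoothing_apply_smoothing hα.le hβ hs ht, hS.apply_smoothing (by positivity) hs ht,
    add_comm α]

section Injective

variable (hA : ∀ x : (generator S).domain, generator S x = 0 → x = 0)
include hA

/-- Raise α to an integer, then remove the factors A one at a time by injectivity. -/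
theorem eq_zero_of_forall_smoothing {α : ℝ} (hα : 0 ≤ α) {x : B}
    (h : ∀ t, 0 < t → smoothing S α t x = 0) : x = 0 := by
  obtain ⟨n, hn⟩ := exists_nat_ge α
  have hn' : ∀ t, 0 < t → smoothing S n t x = 0 := by
    intro t ht
    have := hS.smoothing_apply_smoothing (sub_nonneg.2 hn) hα (half_pos ht) (half_pos ht) x
    rw [h _ (half_pos ht), map_zero, sub_add_cancel, add_halves] at this
    exact this.symm
  have hdown : ∀ k : ℕ, (∀ t, 0 < t → smoothing S k t x = 0) → x = 0 := by
    intro k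
    induction k with
    | zero =>
      intro h0
      refine hS.eq_zero_of_forall fun t ht => ?_
      simpa [smoothing_zero] using h0 t ht
    | succ k ih =>
      intro hk
      refine ih fun t ht => ?_
      have hm := hS.smoothing_mem_graph_generator (α := k) (by positivity) ht x
      have hz := hk t ht
      push_cast at hz
      rw [hz, neg_zero, LinearPMap.mem_graph_iff] at hm
      obtain ⟨y, hy1, hy2⟩ := hm
      exact hy1.symm.trans (by rw [hA y hy2]; rfl)
  exact hdown n hn'

theorem mem_graph_fracPow_neg {γ : ℝ} (hγ : 0 < γ) (x y : B) :
    (x, y) ∈ (fracPow S (-γ)).graph ↔ ∀ t, 0 < t → smoothing S γ t y = S t x := by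
  -- Injectivity is what makes the graph of the inverse the swapped graph.
  have hker : (limitOp (fracPowSemigroup S γ)).toFun.ker = ⊥ := by
    rw [LinearMap.ker_eq_bot']
    intro z hz
    have hg := (limitOp (fracPowSemigroup S γ)).mem_graph z
    have hz' : limitOp (fracPowSemigroup S γ) z = 0 := hz
    rw [hz', hS.mem_graph_limitOp_fracPowSemigroup hγ] at hg
    refine Subtype.ext (hS.eq_zero_of_forall_smoothing hA hγ.le fun t ht => ?_)
    rw [hg t ht, map_zero]
  rw [fracPow, if_neg (by linarith), if_neg (by linarith), neg_neg, LinearPMap.inverse_graph hker,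
    ← hS.mem_graph_limitOp_fracPowSemigroup hγ]
  simp

end Injective

/-- If `(-A)^ρ x = y`, then `(-A)^σ S u x` is controlled by `‖x‖ + ‖y‖`, with a singularity of order
`σ - ρ` at `u = 0` if this is nonnegative, and without singularity otherwise. -/
theorem norm_smoothing_apply_le_of_mem_graph {σ ρ : ℝ} (hσ : 0 < σ) (hρ : 0 < ρ) :
    ∃ C, 0 ≤ C ∧ ∀ x y : B, (∀ t, 0 < t → smoothing S ρ t x = S t y) → ∀ u, 0 < u →
      ‖smoothing S σ u x‖ ≤ C * (‖x‖ + ‖y‖) * u ^ (-max (σ - ρ) 0) := by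
  have hS' := hS.isSmoothingSemigroup
  -- If ρ ≤ σ, then (-A)^σ S(u) x = (-A)^(σ - ρ) S(u) y.
  rcases le_or_gt ρ σ with h | h
  · obtain ⟨C, hC, hb⟩ := hS'.norm_smoothing_le (sub_nonneg.2 h)
    refine ⟨C, hC, fun x y hxy u hu => ?_⟩
    have hu2 := half_pos hu
    have e1 := hS.smoothing_apply_smoothing (sub_nonneg.2 h) hρ.le hu2 hu2 x
    rw [hxy _ hu2, hS.smoothing_apply (sub_nonneg.2 h) hu2 hu2, add_halves, sub_add_cancel] at e1
    rw [← e1, max_eq_left (sub_nonneg.2 h)]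
    refine ((smoothing S (σ - ρ) u).le_opNorm y).trans ?_
    calc ‖smoothing S (σ - ρ) u‖ * ‖y‖ ≤ C * u ^ (-(σ - ρ)) * (‖x‖ + ‖y‖) :=
          mul_le_mul (hb u hu) (by linarith [norm_nonneg x]) (norm_nonneg _) (by positivity)
      _ = _ := by ring
  -- If σ < ρ, write (-A)^σ S(u) x as a Weyl integral of (-A)^ρ S(u + v) x. For v ≤ 1 this integrand
  -- is S(u + v) y, bounded by M‖y‖; for v > 1 it decays like v^(-ρ)‖x‖.
  · obtain ⟨M, hM, hMb⟩ := hS'.bounded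
    obtain ⟨C, hC, hb⟩ := hS'.norm_smoothing_le hρ.le
    have hG := Real.Gamma_pos_of_pos (sub_pos.2 h)
    refine ⟨(Real.Gamma (ρ - σ))⁻¹ * (M * (1 / (ρ - σ)) + C * (1 / σ)), ?_,
      fun x y hxy u hu => ?_⟩
    · have := sub_pos.2 h
      positivity
    rw [max_eq_right (by linarith), neg_zero, Real.rpow_zero, mul_one,
      hS'.smoothing_eq_weyl_smoothing hσ h hu]
    have hi := (hS'.powerDecay_smoothing hρ.le).integrable (sub_pos.2 h) (by linarith) hu
    have e : weyl (ρ - σ) (smoothing S ρ) u x = (Real.Gamma (ρ - σ))⁻¹ •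
        ∫ v in Set.Ioi (0 : ℝ), v ^ (ρ - σ - 1) • smoothing S ρ (u + v) x := by
      rw [weyl, smul_apply, ContinuousLinearMap.integral_apply hi]
      rfl
    rw [e, norm_smul, norm_inv, Real.norm_of_nonneg hG.le, mul_assoc]
    refine mul_le_mul_of_nonneg_left ?_ (by positivity)
    have hcont : ContinuousOn (fun v => smoothing S ρ (u + v) x) (Set.Ioi 0) :=
      continuousOn_add_left (f := fun v => smoothing S ρ v x) (fun t ht =>
        (hS.hasDerivAt_smoothing_apply hρ.le ht x).continuousAt.continuousWithinAt) hu
    refine (integrableOn_rpow_smul (A := M * ‖y‖) (C := C * ‖x‖) (sub_pos.2 h)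
      (by linarith : ρ - σ < ρ) one_pos hcont (fun v hv _ => ?_) (fun v hv => ?_)).2.trans ?_
    · rw [hxy _ (add_pos hu hv)]
      exact ((S (u + v)).le_opNorm y).trans
        (mul_le_mul_of_nonneg_right (hMb _ (add_pos hu hv)) (norm_nonneg _))
    · have hv0 : 0 < v := one_pos.trans hv
      refine ((smoothing S ρ (u + v)).le_opNorm x).trans ?_
      rw [mul_right_comm]
      refine mul_le_mul_of_nonneg_right ((hb _ (add_pos hu hv0)).trans ?_) (norm_nonneg _)
      exact mul_le_mul_of_nonneg_left
        (Real.rpow_le_rpow_of_nonpos hv0 (by linarith) (by linarith)) hC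
    · rw [Real.one_rpow, Real.one_rpow, sub_sub_cancel]
      have := sub_pos.2 h
      have hx := norm_nonneg x
      have hy := norm_nonneg y
      have p1 : 0 ≤ M * (1 / (ρ - σ)) := by positivity
      have p2 : 0 ≤ C * (1 / σ) := by positivity
      nlinarith

end IsBoundedAnalyticSemigroup

end

/-! ### The scale of spaces and the extended semigroup -/

section

variable {B : Type u} [NormedAddCommGroup B] [NormedSpace ℂ B]

theorem FracDomain.norm_pow_le (S : ℝ → B →L[ℂ] B) (ρ : ℝ) (x : FracDomain S ρ) :
    ‖FracDomain.pow S ρ x‖ ≤ ‖x‖ :=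
  le_max_right ‖(FracDomain.normMap S ρ x).1‖ _

theorem FracDomain.norm_incl_le (S : ℝ → B →L[ℂ] B) {ρ : ℝ} (hρ : 0 ≤ ρ) (x : FracDomain S ρ) :
    ‖FracDomain.incl S ρ x‖ ≤ ‖x‖ := by
  rw [FracDomain.norm_of_nonneg S hρ]
  exact le_max_left _ _

theorem FracDomain.mem_graph (S : ℝ → B →L[ℂ] B) (ρ : ℝ) (x : FracDomain S ρ) :
    (FracDomain.incl S ρ x, FracDomain.pow S ρ x) ∈ (fracPow S ρ).graph :=
  LinearPMap.mem_graph (fracPow S ρ) x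

theorem FracDomain.normMap_of_nonneg (S : ℝ → B →L[ℂ] B) {ρ : ℝ} (hρ : 0 ≤ ρ)
    (x : FracDomain S ρ) :
    FracDomain.normMap S ρ x = (FracDomain.incl S ρ x, FracDomain.pow S ρ x) := by
  simp [FracDomain.normMap, hρ]

theorem FracDomain.exists_normMap_eq (S : ℝ → B →L[ℂ] B) {ρ : ℝ} (hρ : 0 ≤ ρ) {w : B × B}
    (hw : w ∈ (fracPow S ρ).graph) : ∃ x : FracDomain S ρ, FracDomain.normMap S ρ x = w := by
  obtain ⟨z, hz1, hz2⟩ := (LinearPMap.mem_graph_iff _).1 hw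
  exact ⟨z, (FracDomain.normMap_of_nonneg S hρ z).trans (Prod.ext hz1 hz2)⟩

theorem FracDomain.dist_eq (S : ℝ → B →L[ℂ] B) (ρ : ℝ) (x y : FracDomain S ρ) :
    dist x y = ‖FracDomain.normMap S ρ x - FracDomain.normMap S ρ y‖ := by
  rw [dist_eq_norm, ← map_sub]
  rfl

theorem FracDomain.isInducing_normMap (S : ℝ → B →L[ℂ] B) (ρ : ℝ) :
    IsInducing (FracDomain.normMap S ρ) := ⟨rfl⟩

theorem denseRange_toComplL (S : ℝ → B →L[ℂ] B) (ρ : ℝ) :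
    DenseRange (UniformSpace.Completion.toComplL (𝕜 := ℂ) (E := FracDomain S ρ)).toLinearMap :=
  UniformSpace.Completion.denseRange_coe

/-- The continuous extension to `Scale S ρ` of a linear map on `D((-A)^ρ)`. -/
def scaleExtend [CompleteSpace B] {S : ℝ → B →L[ℂ] B} {ρ : ℝ} (f : FracDomain S ρ →ₗ[ℂ] B) :
    Scale S ρ →L[ℂ] B :=
  f.extendOfNorm (UniformSpace.Completion.toComplL (𝕜 := ℂ) (E := FracDomain S ρ)).toLinearMap

section

variable [CompleteSpace B] {S : ℝ → B →L[ℂ] B} {ρ : ℝ} {f : FracDomain S ρ →ₗ[ℂ] B}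

theorem scaleExtend_coe (hf : ∀ x, ‖f x‖ ≤ ‖x‖) (x : FracDomain S ρ) :
    scaleExtend f (x : Scale S ρ) = f x :=
  LinearMap.extendOfNorm_eq (denseRange_toComplL S ρ) ⟨1, fun x => by
    simpa [UniformSpace.Completion.norm_coe] using hf x⟩ x

theorem norm_scaleExtend_le (hf : ∀ x, ‖f x‖ ≤ ‖x‖) (x : Scale S ρ) :
    ‖scaleExtend f x‖ ≤ ‖x‖ := by
  have := LinearMap.norm_extendOfNorm_apply_le (f := f) (denseRange_toComplL S ρ) 1 (fun x => by
    simpa [UniformSpace.Completion.norm_coe] using hf x) x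
  rwa [one_mul] at this

end

theorem rpow_neg_le_mul_rpow_neg {u T a b : ℝ} (hu : 0 < u) (huT : u ≤ T) (hab : a ≤ b) :
    u ^ (-a) ≤ T ^ (b - a) * u ^ (-b) := by
  have : u ^ (-a) = u ^ (b - a) * u ^ (-b) := by rw [← Real.rpow_add hu]; ring_nf
  rw [this]
  exact mul_le_mul_of_nonneg_right (Real.rpow_le_rpow hu.le huT (sub_nonneg.2 hab))
    (Real.rpow_nonneg hu.le _)

variable [CompleteSpace B] {S : ℝ → B →L[ℂ] B}

/-- A bounded extension from a dense subspace is unique. -/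
theorem extendedSemigroup_eq_smoothing {γ : ℝ} {J : Scale S (-γ) →L[ℂ] B} {β : ℝ}
    (hJ : ∀ x : FracDomain S (-γ), ∀ t, 0 < t →
      S t (FracDomain.incl S (-γ) x) = smoothing S β t (J x)) {u : ℝ} (hu : 0 < u) :
    extendedSemigroup S (-γ) u = (smoothing S β u).comp J := by
  refine LinearMap.extendOfNorm_unique (denseRange_toComplL S (-γ)) ‖(smoothing S β u).comp J‖
    (fun x => ?_) _ ?_
  · have e : ((S u).toLinearMap ∘ₗ FracDomain.incl S (-γ)) x = ((smoothing S β u).comp J) x :=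
      hJ x u hu
    rw [e]
    exact ContinuousLinearMap.le_opNorm _ _
  · ext x
    exact (hJ x u hu).symm

/-- On `Scale S (-γ)` the semigroup factors through a bounded operator `J` into `B`. The bound
quantifies the smoothing effect of the operators `(-A)^σ S u`. -/
theorem exists_scale_factorization (hS : IsBoundedAnalyticSemigroup S)
    (hA : ∀ x : (generator S).domain, generator S x = 0 → x = 0) (γ : ℝ) :
    ∃ J : Scale S (-γ) →L[ℂ] B,
      (∀ x : FracDomain S (-γ), ∀ t, 0 < t →
        S t (FracDomain.incl S (-γ) x) = smoothing S (max γ 0) t (J x)) ∧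
      ∀ σ T b, 0 < σ → 0 < T → 0 ≤ b → σ - max γ 0 + γ ≤ b →
        ∃ C, 0 ≤ C ∧ ∀ u, 0 < u → u ≤ T → ∀ x, ‖smoothing S σ u (J x)‖ ≤ C * u ^ (-b) * ‖x‖ := by
  have hS' := hS.isSmoothingSemigroup
  rcases le_or_gt 0 γ with hγ | hγ
  -- For γ ≥ 0, J extends (-A)^(-γ), which is bounded for the norm of its domain.
  · have hf := FracDomain.norm_pow_le S (-γ)
    refine ⟨scaleExtend (FracDomain.pow S (-γ)), fun x t ht => ?_, fun σ T b hσ hT hb hσb => ?_⟩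
    · rw [max_eq_left hγ, scaleExtend_coe hf]
      have hx := FracDomain.mem_graph S (-γ) x
      rcases hγ.eq_or_lt with h0 | hγ
      · have h1 : ¬ (0 < -γ) := by linarith
        have h2 : -γ = 0 := by linarith
        rw [fracPow, if_neg h1, if_pos h2, LinearPMap.mem_graph_iff] at hx
        obtain ⟨y, hy1, hy2⟩ := hx
        have h3 : smoothing S γ t = S t := if_pos h0.symm
        rw [h3]
        exact congrArg (S t) (hy1.symm.trans hy2)
      · exact ((hS.mem_graph_fracPow_neg hA hγ _ _).1 hx t ht).symm
    · rw [max_eq_left hγ] at hσb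
      obtain ⟨C, hC, h⟩ := hS'.norm_smoothing_le hσ.le
      refine ⟨C * T ^ (b - σ), by positivity, fun u hu huT x => ?_⟩
      refine ((smoothing S σ u).le_opNorm _).trans (mul_le_mul ((h u hu).trans ?_)
        (norm_scaleExtend_le hf x) (norm_nonneg _) (by positivity))
      rw [mul_assoc]
      exact mul_le_mul_of_nonneg_left (rpow_neg_le_mul_rpow_neg hu huT (by linarith)) hC
  -- For γ < 0, J extends the inclusion into B; the extra regularity enters through `hrel`, carried
  -- to the completion by density.
  · have hρ : 0 < -γ := by linarith
    have hf := FracDomain.norm_incl_le S hρ.le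
    have hg := FracDomain.norm_pow_le S (-γ)
    refine ⟨scaleExtend (FracDomain.incl S (-γ)), fun x t ht => ?_, fun σ T b hσ hT hb hσb => ?_⟩
    · rw [max_eq_right hγ.le, scaleExtend_coe hf, smoothing_zero]
    · rw [max_eq_right hγ.le] at hσb
      have hrel : ∀ x : Scale S (-γ), ∀ t, 0 < t →
          smoothing S (-γ) t (scaleExtend (FracDomain.incl S (-γ)) x) =
            S t (scaleExtend (FracDomain.pow S (-γ)) x) := by
        intro x t ht
        induction x using UniformSpace.Completion.induction_on with
        | hp => exact isClosed_eq (by fun_prop) (by fun_prop)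
        | ih x =>
          rw [scaleExtend_coe hf, scaleExtend_coe hg]
          exact (hS.mem_graph_fracPow_of_pos hρ _ _).1 (FracDomain.mem_graph S (-γ) x) t ht
      obtain ⟨C, hC, h⟩ := hS.norm_smoothing_apply_le_of_mem_graph hσ hρ
      refine ⟨C * 2 * T ^ (b - max (σ - -γ) 0), by positivity, fun u hu huT x => ?_⟩
      refine (h _ _ (hrel x) u hu).trans ?_
      have h1 := norm_scaleExtend_le hf x
      have h2 := norm_scaleExtend_le hg x
      have h3 := rpow_neg_le_mul_rpow_neg hu huT
        (show max (σ - -γ) 0 ≤ b from max_le (by linarith) hb)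
      calc _ ≤ C * (2 * ‖x‖) * (T ^ (b - max (σ - -γ) 0) * u ^ (-b)) := by
            gcongr
            linarith
        _ = _ := by ring

end

/-! ### The concrete kernel, with values in B × B -/

section

variable {B : Type u} [NormedAddCommGroup B] [NormedSpace ℂ B] {X : Type*} [NormedAddCommGroup X]
  [NormedSpace ℂ X]

/-- The operators `x ↦ (c (-A)^α S u J x, c (-A)^β S u J x)`. -/
def smoothingPair (S : ℝ → B →L[ℂ] B) (J : X →L[ℂ] B) (α β u : ℝ) : X →L[ℂ] B × B :=
  (ContinuousLinearMap.inl ℂ B B).comp ((smoothing S α u).comp J) +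
    (ContinuousLinearMap.inr ℂ B B).comp ((smoothing S β u).comp J)

theorem smoothingPair_apply (S : ℝ → B →L[ℂ] B) (J : X →L[ℂ] B) (α β u : ℝ) (x : X) :
    smoothingPair S J α β u x = (smoothing S α u (J x), smoothing S β u (J x)) := by
  simp [smoothingPair]

theorem isSingularKernel_smoothingPair [CompleteSpace B] {S : ℝ → B →L[ℂ] B}
    (hS : IsBoundedAnalyticSemigroup S) (J : X →L[ℂ] B) {α β T C₁ C₂ ν : ℝ} (hα : 0 ≤ α)
    (hβ : 0 ≤ β) (hC₁ : 0 ≤ C₁)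
    (h₁ : ∀ u, 0 < u → u ≤ T → ∀ x, ‖smoothing S (α + 1) u (J x)‖ ≤ C₁ * u ^ (-(1 + ν)) * ‖x‖)
    (h₂ : ∀ u, 0 < u → u ≤ T → ∀ x, ‖smoothing S (β + 1) u (J x)‖ ≤ C₂ * u ^ (-(1 + ν)) * ‖x‖) :
    IsSingularKernel (smoothingPair S J α β) (fun u => -smoothingPair S J (α + 1) (β + 1) u) T
      (max C₁ C₂) ν := by
  have hS' := hS.isSmoothingSemigroup
  refine ⟨fun u hu x => ?_, ?_, hC₁.trans (le_max_left _ _), fun u hu huT => ?_⟩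
  · simp only [smoothingPair_apply, neg_apply]
    exact (hS.hasDerivAt_smoothing_apply hα hu (J x)).prodMk
      (hS.hasDerivAt_smoothing_apply hβ hu (J x))
  · have c1 := hS'.continuousOn_smoothing (show 0 ≤ α + 1 by positivity)
    have c2 := hS'.continuousOn_smoothing (show 0 ≤ β + 1 by positivity)
    exact ((continuousOn_const.clm_comp (c1.clm_comp continuousOn_const)).add
      (continuousOn_const.clm_comp (c2.clm_comp continuousOn_const))).neg
  · have hC := hC₁.trans (le_max_left C₁ C₂)
    have e : -1 - ν = -(1 + ν) := by ring
    rw [norm_neg, e]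
    refine ContinuousLinearMap.opNorm_le_bound _ (by positivity) fun x => ?_
    rw [smoothingPair_apply, Prod.norm_def]
    refine max_le ((h₁ u hu huT x).trans ?_) ((h₂ u hu huT x).trans ?_)
    · gcongr
      exact le_max_left _ _
    · gcongr
      exact le_max_right _ _

end

/-! ### Hölder paths and integrals in the domain of a fractional power -/

theorem memHolderZero_of_dist_le {E : Type*} [SeminormedAddCommGroup E] {κ T D : ℝ} (hκ : 0 < κ)
    (hD : 0 ≤ D) {f : ℝ → E} (h0 : f 0 = 0)
    (h : ∀ s ∈ Set.Icc 0 T, ∀ t ∈ Set.Icc 0 T, dist (f s) (f t) ≤ D * |s - t| ^ κ) :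
    MemHolderZero κ T f := by
  refine ⟨h0, D.toNNReal, fun s hs t ht => ?_⟩
  rw [edist_dist, edist_dist, Real.coe_toNNReal κ hκ.le, ENNReal.ofReal_rpow_of_nonneg dist_nonneg
    hκ.le]
  change _ ≤ ENNReal.ofReal D * _
  rw [← ENNReal.ofReal_mul hD, Real.dist_eq]
  exact ENNReal.ofReal_le_ofReal (h s hs t ht)

theorem MemHolderZero.exists_isHolderPath {E : Type*} [NormedAddCommGroup E] {η T : ℝ} (hη : 0 < η)
    {f : ℝ → E} (hf : MemHolderZero η T f) : ∃ L, 0 ≤ L ∧ IsHolderPath f T L η := by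
  obtain ⟨-, C, hC⟩ := hf
  refine ⟨C, C.2, fun s hs t ht => ?_⟩
  have := hC s hs t ht
  rw [edist_dist, edist_dist, Real.coe_toNNReal η hη.le, ENNReal.ofReal_rpow_of_nonneg dist_nonneg
    hη.le, ← ENNReal.ofReal_coe_nnreal, ← ENNReal.ofReal_mul C.coe_nonneg,
    ENNReal.ofReal_le_ofReal_iff (by positivity), dist_eq_norm, Real.dist_eq] at this
  exact this

section

variable {B : Type u} [NormedAddCommGroup B] [NormedSpace ℂ B]
  {S : ℝ → B →L[ℂ] B}

/-- The graph is a common kernel of bounded operators, and these commute with the integral. -/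
theorem IsBoundedAnalyticSemigroup.integral_mem_graph_fracPow [CompleteSpace B]
    (hS : IsBoundedAnalyticSemigroup S)
    {δ a b : ℝ} (hδ : 0 < δ) (hab : a ≤ b) {f : ℝ → B × B}
    (hi : IntegrableOn f (Set.Ioc a b)) (hf : ∀ s ∈ Set.Ioc a b, f s ∈ (fracPow S δ).graph) :
    ∫ s in a..b, f s ∈ (fracPow S δ).graph := by
  have key : ∀ w : B × B, w ∈ (fracPow S δ).graph ↔ ∀ t, 0 < t →
      ((smoothing S δ t).comp (ContinuousLinearMap.fst ℂ B B) -
        (S t).comp (ContinuousLinearMap.snd ℂ B B)) w = 0 := fun w => by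
    rw [← Prod.mk.eta (p := w), hS.mem_graph_fracPow_of_pos hδ]
    simp [sub_eq_zero]
  rw [key]
  intro t ht
  rw [← ContinuousLinearMap.intervalIntegral_comp_comm _
    ((intervalIntegrable_iff_integrableOn_Ioc_of_le hab).2 hi),
    intervalIntegral.integral_of_le hab]
  exact setIntegral_eq_zero_of_forall_eq_zero fun s hs => (key _).1 (hf s hs) t ht

theorem integrableOn_of_normMap {δ : ℝ} {g : ℝ → B × B} {G : ℝ → FracDomain S δ} {t : ℝ}
    (hg : IntegrableOn g (Set.Ioc 0 t)) (hc : ContinuousOn g (Set.Ico 0 t))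
    (hG : ∀ s ∈ Set.Icc 0 t, FracDomain.normMap S δ (G s) = g s) :
    IntegrableOn G (Set.Ioc 0 t) := by
  -- Continuity of g is not available at t, so the null endpoint is dropped before measurability is
  -- read off.
  rw [IntegrableOn, ← Measure.restrict_congr_set (Ioo_ae_eq_Ioc (μ := volume))]
  have hc' : ContinuousOn G (Set.Ioo 0 t) := by
    rw [(FracDomain.isInducing_normMap S δ).continuousOn_iff]
    exact (hc.mono Set.Ioo_subset_Ico_self).congr fun s hs => hG s (Set.Ioo_subset_Icc_self hs)
  refine ⟨hc'.aestronglyMeasurable measurableSet_Ioo, ?_⟩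
  refine lt_of_eq_of_lt (lintegral_congr_ae ?_) (hg.mono_set Set.Ioo_subset_Ioc_self).2
  refine (ae_restrict_iff' measurableSet_Ioo).2 (Eventually.of_forall fun s hs => ?_)
  beta_reduce
  rw [← hG s (Set.Ioo_subset_Icc_self hs)]
  rfl

end

end AnalyticConvolution

end

/-! ### The theorem -/

open AnalyticConvolution
theorem proposition4 {B : Type*} [NormedAddCommGroup B] [NormedSpace ℂ B] [CompleteSpace B]
    (S : ℝ → B →L[ℂ] B) (hS : IsBoundedAnalyticSemigroup S)
    (hA : ∀ x : (generator S).domain, generator S x = 0 → x = 0)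
    (η γ δ κ T : ℝ) (hη : 0 < η) (hη1 : η ≤ 1) (hγη : γ < η) (hT : 0 < T)
    (hδ : 0 < δ) (hδ1 : δ < η - γ)
    (hκ : 0 < κ) (hκ1 : κ < min (η - γ - δ) 1) (hκη : κ ≤ η)
    (N : ℝ → Scale S (-γ)) (hN : MemHolderZero η T N) :
    -- for `u > 0`, the operator `S u` extends from `D((-A)^(-γ))` to its completion
    (∀ u : ℝ, 0 < u → ∃ C : ℝ, ∀ x : FracDomain S (-γ),
      ‖S u (FracDomain.incl S (-γ) x)‖ ≤ C * ‖x‖) ∧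
    -- the convolution `Y t = ∫₀ᵗ S(t - s) dN(s)` exists as a Hölder path in `D((-A)^δ)`
    ∃ Y : ℝ → FracDomain S δ, MemHolderZero κ T Y ∧
      ∀ t ∈ Set.Icc 0 T, IsConvolution S N t (Y t) ∧
        -- `G s = A S(t - s) (N(s) - N(t))` is Bochner integrable in `D((-A)^δ)`
        ∃ G : ℝ → FracDomain S δ,
          (∀ s ∈ Set.Ico 0 t, (extendedSemigroup S (-γ) (t - s) (N s - N t),
            FracDomain.incl S δ (G s)) ∈ (generator S).graph) ∧
          IntegrableOn G (Set.Ioc 0 t) ∧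
          FracDomain.incl S δ (Y t) =
            (∫ s in (0 : ℝ)..t, FracDomain.incl S δ (G s)) + extendedSemigroup S (-γ) t (N t) := by
  obtain ⟨J, hJ, hJb⟩ := exists_scale_factorization hS hA γ
  set β := max γ 0 with hβ_def
  have hβ : 0 ≤ β := le_max_right _ _
  have hγβ : γ ≤ β := le_max_left _ _
  have hE : ∀ u, 0 < u → ∀ x, extendedSemigroup S (-γ) u x = smoothing S β u (J x) := fun u hu x => by
    rw [extendedSemigroup_eq_smoothing hJ hu]; rfl
  refine ⟨fun u hu => ⟨‖(smoothing S β u).comp J‖, fun x => ?_⟩, ?_⟩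
  · rw [hJ x u hu]
    exact (((smoothing S β u).comp J).le_opNorm x).trans_eq
      (by rw [UniformSpace.Completion.norm_coe])
  -- the kernel of the convolution
  obtain ⟨L, hL, hNL⟩ := hN.exists_isHolderPath hη
  have hN0 : N 0 = 0 := hN.1
  -- The cap at -1 keeps the exponent 1 + ν nonnegative, as the bound for J demands; κ < η - ν then
  -- uses κ ≤ η as well as κ < η - γ - δ.
  set ν := max (γ + δ) (-1) with hν_def
  have hν1 : γ + δ ≤ ν := le_max_left _ _
  have hν2 : -1 ≤ ν := le_max_right _ _
  have hκν : κ < η - ν := by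
    have h1 : κ < η - γ - δ := hκ1.trans_le (min_le_left _ _)
    have : ν < η - κ := max_lt (by linarith) (by linarith)
    linarith
  -- The components have singularities of orders 1 + γ and 1 + γ + δ, both at most 1 + ν.
  obtain ⟨C₁, hC₁, h₁⟩ := hJb (β + 1) T (1 + ν) (by linarith) hT (by linarith) (by linarith)
  obtain ⟨C₂, hC₂, h₂⟩ := hJb (β + δ + 1) T (1 + ν) (by linarith) hT (by linarith) (by linarith)
  have hK := isSingularKernel_smoothingPair hS J hβ (by linarith : 0 ≤ β + δ) hC₁ h₁ h₂
  set K := smoothingPair S J β (β + δ) with hK_def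
  set K' := fun u => -smoothingPair S J (β + 1) (β + δ + 1) u with hK'_def
  have hKgraph : ∀ u, 0 < u → ∀ x, K u x ∈ (fracPow S δ).graph := fun u hu x => by
    rw [hK_def, smoothingPair_apply]
    exact hS.smoothing_mem_graph_fracPow hδ hβ hu (J x)
  have hK'graph : ∀ u, 0 < u → ∀ x, K' u x ∈ (fracPow S δ).graph := fun u hu x => by
    have := hS.smoothing_mem_graph_fracPow hδ (show 0 ≤ β + 1 by linarith) hu (J x)
    rw [add_right_comm] at this
    simp only [hK'_def, neg_apply, smoothingPair_apply]
    exact Submodule.neg_mem _ this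
  have hK1 : ∀ u, 0 < u → ∀ x, (K u x).1 = extendedSemigroup S (-γ) u x := fun u hu x => by
    rw [hK_def, smoothingPair_apply, hE u hu]
  have hK'graph' : ∀ t, ∀ s ∈ Set.Icc 0 t, K' (t - s) (N s - N t) ∈ (fracPow S δ).graph := by
    intro t s hs
    -- At s = t the kernel acts on 0, so its value at 0 does not matter.
    rcases hs.2.eq_or_lt with rfl | hst
    · simp
    · exact hK'graph _ (sub_pos.2 hst) _
  have hint : ∀ t ∈ Set.Icc 0 T, IntegrableOn (fun s => K' (t - s) (N s - N t)) (Set.Ioc 0 t) :=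
    fun t ht => integrableOn_kernel_integrand hK hNL hL hη hκ hκη hκν ht.2
  have hYgraph : ∀ t, t ∈ Set.Icc 0 T → ∃ y : FracDomain S δ,
      FracDomain.normMap S δ y = kernelConvolution K K' N t := by
    intro t ht
    refine FracDomain.exists_normMap_eq S hδ.le (Submodule.add_mem _ ?_ ?_)
    · rcases ht.1.eq_or_lt with rfl | ht0
      · simp [hN0]
      · exact hKgraph t ht0 _
    · exact hS.integral_mem_graph_fracPow hδ ht.1 (hint t ht) fun s hs =>
        hK'graph' t s (Set.Ioc_subset_Icc_self hs)
  have : Nonempty (FracDomain S δ) := ⟨0⟩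
  choose! Y hY using hYgraph
  refine ⟨Y, ?_, fun t ht => ⟨?_, ?_⟩⟩
  · obtain ⟨D, hD, hDb⟩ :=
      exists_norm_kernelConvolution_sub_le hK hNL hL hη hκ hκη hκν hN0 hT
    refine memHolderZero_of_dist_le hκ hD ?_ fun s hs t ht => ?_
    · have h0 := hY 0 ⟨le_rfl, hT.le⟩
      rw [FracDomain.normMap_of_nonneg S hδ.le, kernelConvolution, hN0, map_zero,
        intervalIntegral.integral_same, add_zero] at h0
      exact Subtype.ext (congrArg Prod.fst h0)
    · rw [FracDomain.dist_eq, hY s hs, hY t ht]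
      exact hDb s hs t ht
  · intro π hπ
    have hR : ∀ n, ∃ R : FracDomain S δ, FracDomain.normMap S δ R =
        ∑ k ∈ Finset.range (π n).m,
          K (t - (π n).pt k) (N ((π n).pt (k + 1)) - N ((π n).pt k)) := fun n =>
      FracDomain.exists_normMap_eq S hδ.le (Submodule.sum_mem _ fun k hk =>
        hKgraph _ (sub_pos.2 ((π n).pt_lt_last (Finset.mem_range.1 hk))) _)
    choose R hR using hR
    refine ⟨R, fun n => ?_, ?_⟩
    · have := congrArg Prod.fst (hR n)
      rw [FracDomain.normMap_of_nonneg S hδ.le, Prod.fst_sum] at this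
      exact this.trans (Finset.sum_congr rfl fun k hk =>
        hK1 _ (sub_pos.2 ((π n).pt_lt_last (Finset.mem_range.1 hk))) _)
    · rw [tendsto_iff_dist_tendsto_zero]
      have hlim : Tendsto (fun n => max C₁ C₂ * (L * (π n).mesh ^ κ) *
          ∫ s in (0 : ℝ)..t, (t - s) ^ (η - κ - 1 - ν)) atTop (𝓝 0) := by
        have h1 := hπ.rpow_const (p := κ) (Or.inr hκ.le)
        rw [Real.zero_rpow hκ.ne'] at h1
        simpa using ((h1.const_mul L).const_mul (max C₁ C₂)).mul_const
          (∫ s in (0 : ℝ)..t, (t - s) ^ (η - κ - 1 - ν))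
      refine squeeze_zero (fun n => dist_nonneg) (fun n => ?_) hlim
      rw [FracDomain.dist_eq, hR, hY t ht]
      exact norm_kernel_riemann_sum_sub_le hK hNL hL hη hκ hκη hκν hN0 ht.2 (π n)
  · have hG : ∀ s, s ∈ Set.Icc 0 t → ∃ z : FracDomain S δ,
        FracDomain.normMap S δ z = K' (t - s) (N s - N t) := fun s hs =>
      FracDomain.exists_normMap_eq S hδ.le (hK'graph' t s hs)
    choose! G hG using hG
    have hG1 : ∀ s ∈ Set.Icc 0 t, FracDomain.incl S δ (G s) = (K' (t - s) (N s - N t)).1 := by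
      intro s hs
      rw [← hG s hs, FracDomain.normMap_of_nonneg S hδ.le]
    refine ⟨G, fun s hs => ?_, ?_, ?_⟩
    · rw [hG1 s (Set.Ico_subset_Icc_self hs), hE _ (sub_pos.2 hs.2)]
      simp only [hK'_def, neg_apply, smoothingPair_apply]
      exact hS.smoothing_mem_graph_generator hβ (sub_pos.2 hs.2) _
    · exact integrableOn_of_normMap (hint t ht)
        (continuousOn_kernel_integrand hK hNL hη ht.2 (N t)) hG
    · have h1 := congrArg Prod.fst (hY t ht)
      rw [FracDomain.normMap_of_nonneg S hδ.le, kernelConvolution, Prod.fst_add] at h1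
      have h2 : (∫ s in (0 : ℝ)..t, K' (t - s) (N s - N t)).1 =
          ∫ s in (0 : ℝ)..t, FracDomain.incl S δ (G s) := by
        have := (ContinuousLinearMap.fst ℂ B B).intervalIntegral_comp_comm
          ((intervalIntegrable_iff_integrableOn_Ioc_of_le ht.1).2 (hint t ht))
        refine this.symm.trans (intervalIntegral.integral_congr fun s hs => ?_)
        rw [Set.uIcc_of_le ht.1] at hs
        exact (hG1 s hs).symm
      have h3 : (K t (N t)).1 = extendedSemigroup S (-γ) t (N t) := by
        rcases ht.1.eq_or_lt with rfl | ht0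
        · simp [hN0]
        · exact hK1 t ht0 _
      exact h1.trans (by rw [h2, h3, add_comm])
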